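/- **Setting.** A general Markov decision process (gMDP) $\mathbf M=(\mathbb X,\mathbb U,\mathbb Y,\mathbb T,x_0,h)$ has Polish (standard Borel) state and input spaces $\mathbb X,\mathbb U$, a metric output space $\mathbb Y$, a stochastic kernel $\mathbb T(dx'\mid x,u)$, an initial state $x_0$ and a measurable output map $h:\mathbb X\to\mathbb Y$. Let $\mathbf M^1,\dots,\mathbf M^N$ (concrete agents) and $\hat{\mathbf M}^1,\dots,\hat{\mathbf M}^N$ (abstract agents) be gMDPs such that $\mathbf M^i$ and $\hat{\mathbf M}^i$ have the same output space $\mathbb Y_i$, and let $\mathbf M$ and $\hat{\mathbf M}$ be their Cartesian compositions (product spaces, product kernels, componentwise initial states and outputs, and the metric $d(\hat y,y)=\max_i d_i(\hat y_i,y_i)$ on $\mathbb Y=\prod_i\mathbb Y_i$). Each agent has a finite set $\mathrm{AP}_i$ of atomic propositions, these sets being pairwise disjoint, and a measurable labelling $L^i:\mathbb Y_i\to 2^{\mathrm{AP}_i}$; let $L(y)=\bigcup_i L^i(y_i)\in 2^{\mathrm{AP}}$, $\mathrm{AP}=\bigcup_i\mathrm{AP}_i$. The specification $\phi$ is given by a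 deterministic finite automaton with finite state set $Q$, initial state $q_0$, transition function $\tau:Q\times 2^{\mathrm{AP}}\to Q$ and accepting state $q_f$. An execution $x[0],x[1],\dots$ generates the letters $l_t=L(h(x[t]))$, and we put $\bar q_t=\tau(\bar q_{t-1},l_t)$ with $\bar q_{-1}=q_0$. We write $\boldsymbol l_{[0,T]}\models\phi$ if $\bar q_t=q_f$ for some $0\le t\le T$, and $H_{\{q_f\}}=\inf\{t\in\mathbb N:\bar q_t=q_f\}\in\mathbb N\cup\{\infty\}$. A control strategy for $\mathbf M$ assigns, measurably, to each finite history $x[0],u[0],\dots,x[t]$ a probability distribution of the action $u[t]$; it is deterministic if it is a measurable map from histories to actions. **Simulation.** $\hat{\mathbf M}\preceq^{\delta}_{\epsilon}\mathbf M$ means that there are a measurable relation $\mathscr R\subset\hat{\mathbb X}\times\mathbb X$ and stochastic kernels $\mathcal U(du\mid\hat u,\hat x,x)$ on $\mathbb U$ and $\mathbb W(d\hat x'\,dx'\mid\hat u,\hat x,x)$ on $\hat{\mathbb X}\times\mathbb X$ such that $(\hat x_0,x_0)\in\mathscr R$, and such that for all $(\hat x,x)\in\mathscr R$ we have $d(\hat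 h(\hat x),h(x))\le\epsilon$ and, for all $\hat u\in\hat{\mathbb U}$, the measure $\mathbb W(\cdot\mid\hat u,\hat x,x)$ has first marginal $\hat{\mathbb T}(\cdot\mid\hat x,\hat u)$, second marginal $\int\mathbb T(\cdot\mid x,u)\,\mathcal U(du\mid\hat u,\hat x,x)$, and satisfies $\mathbb W(\mathscr R\mid\hat u,\hat x,x)\ge 1-\delta$. **Value functions.** Let $\boldsymbol\pi=(\pi[t])_{t\in\mathbb N}$ be a Markov policy for $\hat{\mathbf M}$ consisting of measurable maps $\pi[t]:\hat{\mathbb X}\times Q\to\hat{\mathbb U}$; under $\boldsymbol\pi$ the action at time $t$ is $\pi[t](\hat x[t],\bar q_t)$. For a horizon $T$, put $\mathscr V_{q,0}=\mathbf 1_{q_f}(q)$ and, for $0\le t<T$, $$\mathscr V^{\boldsymbol\pi}_{q,t+1}(\hat x)=\mathbf 1_{q_f}(q)+\mathbf 1_{Q\setminus\{q_f\}}(q)\int\mathscr V^{\boldsymbol\pi}_{q',t}(\hat x')\,\hat{\mathbb T}\bigl(d\hat x'\mid\hat x,\pi[T-1-t](\hat x,q)\bigr),\qquad q'=\tau(q,L(\hat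 h(\hat x'))).$$ **Proposition ($\mathbf C_{\boldsymbol\pi}$ with satisfaction probability).** Let $\delta\in\mathbb R$ and suppose that $\hat{\mathbf M}\preceq^{\delta}_0\mathbf M$, or that $\hat{\mathbf M}^i\preceq^{\delta^i}_0\mathbf M^i$ with $\delta^i\in[0,1]$ for all $i$ and $\delta=1-\prod_{i=1}^N(1-\delta^i)$. Then for every Markov policy $\boldsymbol\pi$ for $\hat{\mathbf M}$ there is a control strategy $\mathbf C_{\boldsymbol\pi}$ for $\mathbf M$ such that for all $T\ge1$ $$\mathbb P_{\mathbf M\times\mathbf C_{\boldsymbol\pi}}\bigl(\boldsymbol l_{[0,T]}\models\phi\bigr)\ \ge\ \mathscr V^{\boldsymbol\pi}_{\bar q_0,T}(\hat x_0)-\delta\sum_{h=1}^{T}\mathbb P_{\hat{\mathbf M}\times\boldsymbol\pi}\bigl(H_{\{q_f\}}(\hat x_0)\ge h\bigr),\qquad \bar q_0=\tau(q_0,L(\hat h(\hat x_0))).$$ Moreover, for each single $T\ge1$ there is a deterministic control strategy for $\mathbf M$ that satisfies this inequality. -/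

import Mathlib

open MeasureTheory ProbabilityTheory
open scoped ENNReal

/-- A general Markov decision process with state space `X`, input space `U` and output space `Y`:
a stochastic kernel `T(dx' | x, u)`, an initial state and a measurable output map. -/
structure GMDP (X U Y : Type*) [MeasurableSpace X] [MeasurableSpace U] [MeasurableSpace Y] where
  init : X
  kernel : Kernel (X × U) X
  markov : IsMarkovKernel kernel
  out : X → Y
  measurable_out : Measurable out

attribute [instance] GMDP.markov

/-- A (possibly randomised) control strategy: to each finite history `x[0],u[0],x[1],…,x[t]` it
assigns a probability distribution of the action `u[t]`. The history at time `0` is `x[0]`; the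
history at time `n + 1` is `((x[k],u[k]) for k ≤ n)` together with `x[n+1]`. -/
structure Strategy (X U : Type*) [MeasurableSpace X] [MeasurableSpace U] where
  init : Kernel X U
  step : ∀ n : ℕ, Kernel ((Finset.Iic n → X × U) × X) U
  markov_init : IsMarkovKernel init
  markov_step : ∀ n, IsMarkovKernel (step n)

attribute [instance] Strategy.markov_init Strategy.markov_step

/-- The strategy is a (measurable) map from finite histories to actions. -/
def Strategy.IsDeterministic {X U : Type*} [MeasurableSpace X] [MeasurableSpace U]
    (C : Strategy X U) : Prop :=
  (∃ (f : X → U) (hf : Measurable f), C.init = Kernel.deterministic f hf) ∧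
  ∀ n, ∃ (f : (Finset.Iic n → X × U) × X → U) (hf : Measurable f),
    C.step n = Kernel.deterministic f hf

/-- A (mode-dependent) Markov policy: measurable maps `π[t]` assigning an action to each pair of a
system state and an automaton state. -/
structure MarkovPolicy (X Q U : Type*) [MeasurableSpace X] [MeasurableSpace Q]
    [MeasurableSpace U] where
  act : ℕ → X × Q → U
  measurable_act : ∀ t, Measurable (act t)

namespace DFA

variable {α Q : Type*}

/-- The run of the automaton on an infinite word: `q_0 = start`, `q_{t+1} = τ(q_t, l_t)`. -/
def run (𝒜 : DFA α Q) (l : ℕ → α) : ℕ → Q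
  | 0 => 𝒜.start
  | t + 1 => 𝒜.step (𝒜.run l t) (l t)

/-- `l_{[0,T]} ⊨ φ`: after reading `l_0, …, l_t` for some `t ≤ T`, the automaton is accepting. -/
def Satisfies (𝒜 : DFA α Q) (T : ℕ) (l : ℕ → α) : Prop :=
  ∃ t ≤ T, 𝒜.run l (t + 1) ∈ 𝒜.accept

/-- The first time `t ∈ ℕ ∪ {∞}` at which the automaton is accepting after reading
`l_0, …, l_t`. -/
noncomputable def hittingTime (𝒜 : DFA α Q) (l : ℕ → α) : ℕ∞ :=
  ⨅ (t : ℕ) (_ : 𝒜.run l (t + 1) ∈ 𝒜.accept), (t : ℕ∞)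

theorem measurable_run {Ω : Type*} [MeasurableSpace Ω] [Finite α] [MeasurableSpace α]
    [DiscreteMeasurableSpace α] [Finite Q] [MeasurableSpace Q] [DiscreteMeasurableSpace Q]
    (𝒜 : DFA α Q) {l : Ω → ℕ → α} (hl : ∀ k, Measurable fun ω => l ω k) (t : ℕ) :
    Measurable fun ω => 𝒜.run (l ω) t := by
  induction t with
  | zero => exact measurable_const
  | succ t ih =>
    have h : Measurable fun p : Q × α => 𝒜.step p.1 p.2 := Measurable.of_discrete
    exact h.comp (ih.prodMk (hl t))

end DFA

namespace GMDP

section Single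

variable {X U Y α Q : Type*} [MeasurableSpace X] [MeasurableSpace U] [MeasurableSpace Y]

/-- The law of the executions `(x[t], u[t])_{t ∈ ℕ}` of the controlled system `M × C`. -/
noncomputable def closedLoop (M : GMDP X U Y) (C : Strategy X U) : Measure (ℕ → X × U) :=
  Kernel.trajMeasure (X := fun _ => X × U) ((Measure.dirac M.init) ⊗ₘ C.init)
    (fun n => (M.kernel.comap (fun h : Finset.Iic n → X × U => h ⟨n, Finset.mem_Iic.2 le_rfl⟩)
      (measurable_pi_apply _)) ⊗ₖ C.step n)

/-- The word generated by an execution under the labelling `L`. -/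
def word (M : GMDP X U Y) (L : Y → α) (ω : ℕ → X × U) : ℕ → α :=
  fun t => L (M.out (ω t).1)

/-- `P_{M × C}(l_{[0,T]} ⊨ φ)`: the probability that the execution of the controlled system
`M × C` satisfies the specification within the horizon `T`. -/
noncomputable def satProb (M : GMDP X U Y) (𝒜 : DFA α Q) (L : Y → α) (C : Strategy X U)
    (T : ℕ) : ℝ :=
  (M.closedLoop C).real {ω | 𝒜.Satisfies T (M.word L ω)}

/-- The value functions `V_{q,t}` of a Markov policy for the horizon `T`:
`V_{q,0} = 1_{q_f}(q)` and
`V_{q,t+1}(x) = 1_{q_f}(q) + 1_{Q ∖ q_f}(q) E[V_{q',t}(x') | u = π[T-1-t](x, q)]`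
with `q' = τ(q, L(h(x')))`. -/
noncomputable def value [MeasurableSpace Q] (M : GMDP X U Y) (𝒜 : DFA α Q) (L : Y → α)
    (π : MarkovPolicy X Q U) (T : ℕ) : ℕ → Q → X → ℝ≥0∞
  | 0, q, _ => 𝒜.accept.indicator 1 q
  | t + 1, q, x => 𝒜.accept.indicator 1 q + 𝒜.acceptᶜ.indicator 1 q *
      ∫⁻ x', M.value 𝒜 L π T t (𝒜.step q (L (M.out x'))) x'
        ∂(M.kernel (x, π.act (T - 1 - t) (x, q)))

/-- The word read along a finite history (continued by the last letter). -/
def histWord (M : GMDP X U Y) (L : Y → α) (n : ℕ) (p : (Finset.Iic n → X × U) × X) : ℕ → α :=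
  fun k => if hk : k ∈ Finset.Iic n then L (M.out (p.1 ⟨k, hk⟩).1) else L (M.out p.2)

variable [MeasurableSpace α]

theorem measurable_histWord (M : GMDP X U Y) {L : Y → α} (hL : Measurable L) (n k : ℕ) :
    Measurable fun p : (Finset.Iic n → X × U) × X => M.histWord L n p k := by
  unfold histWord
  split_ifs with hk
  · exact hL.comp (M.measurable_out.comp
      (measurable_fst.comp ((measurable_pi_apply _).comp measurable_fst)))
  · exact hL.comp (M.measurable_out.comp measurable_snd)

variable [Finite α] [DiscreteMeasurableSpace α] [Finite Q] [MeasurableSpace Q]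
  [DiscreteMeasurableSpace Q]

/-- A Markov policy as a control strategy: at time `t` apply `π[t](x[t], q)`, where `q` is the
automaton state after reading the labels of `x[0], …, x[t]`. -/
noncomputable def policyStrategy (M : GMDP X U Y) (𝒜 : DFA α Q) {L : Y → α} (hL : Measurable L)
    (π : MarkovPolicy X Q U) : Strategy X U where
  init := Kernel.deterministic (fun x => π.act 0 (x, 𝒜.step 𝒜.start (L (M.out x)))) <|
    (π.measurable_act 0).comp (measurable_id.prodMk
      ((Measurable.of_discrete (f := 𝒜.step 𝒜.start)).comp (hL.comp M.measurable_out)))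
  step n := Kernel.deterministic
    (fun p => π.act (n + 1) (p.2, 𝒜.run (M.histWord L n p) (n + 2))) <|
    (π.measurable_act (n + 1)).comp
      (measurable_snd.prodMk (𝒜.measurable_run (M.measurable_histWord hL n) (n + 2)))
  markov_init := inferInstance
  markov_step _ := inferInstance

/-- `P(H ≥ h)`: the probability that the first hitting time of the accepting automaton state, along
the execution of `M` under the Markov policy `π`, is at least `h`. -/
noncomputable def hitTail (M : GMDP X U Y) (𝒜 : DFA α Q) {L : Y → α} (hL : Measurable L)
    (π : MarkovPolicy X Q U) (h : ℕ) : ℝ :=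
  (M.closedLoop (M.policyStrategy 𝒜 hL π)).real {ω | (h : ℕ∞) ≤ 𝒜.hittingTime (M.word L ω)}

end Single

section Simulation

variable {Xh Uh X U Y : Type*} [MeasurableSpace Xh] [MeasurableSpace Uh] [MeasurableSpace X]
  [MeasurableSpace U] [MeasurableSpace Y]

/-- `W` is a lifting witnessing that `(Δ, Θ)` belongs to the `δ`-lifted relation of `R`. -/
def IsLifting (R : Set (Xh × X)) (δ : ℝ) (Δ : Measure Xh) (Θ : Measure X)
    (W : Measure (Xh × X)) : Prop :=
  (∀ A : Set Xh, MeasurableSet A → W (A ×ˢ Set.univ) = Δ A) ∧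
  (∀ A : Set X, MeasurableSet A → W (Set.univ ×ˢ A) = Θ A) ∧
  1 - δ ≤ W.real R

/-- `Mh` is `(ε, δ)`-stochastically simulated by `M`: there are a measurable relation `R`, an
interface `𝒰` and a lifted kernel `W`, such that the initial states are related, related states
have `ε`-close outputs, and from related states the transition probabilities
`T̂(· | x̂, û)` and `T(· | x, 𝒰(û, x̂, x)) = ∫ T(· | x, u) 𝒰(du | û, x̂, x)` are in the `δ`-lifted
relation, with lifting `W(· | û, x̂, x)`. -/
def SimulatedBy [MetricSpace Y] (Mh : GMDP Xh Uh Y) (M : GMDP X U Y) (ε δ : ℝ) : Prop :=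
  ∃ (R : Set (Xh × X)) (𝒰 : Kernel (Uh × Xh × X) U) (W : Kernel (Uh × Xh × X) (Xh × X)),
    MeasurableSet R ∧ IsMarkovKernel 𝒰 ∧ IsMarkovKernel W ∧
    (Mh.init, M.init) ∈ R ∧
    (∀ xh x, (xh, x) ∈ R → dist (Mh.out xh) (M.out x) ≤ ε) ∧
    ∀ uh xh x, (xh, x) ∈ R →
      IsLifting R δ (Mh.kernel (xh, uh))
        ((𝒰 (uh, xh, x)).bind fun u => M.kernel (x, u)) (W (uh, xh, x))

end Simulation

section MultiAgent

variable {N : ℕ} {X U Y AP : Fin N → Type*} [∀ i, MeasurableSpace (X i)]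
  [∀ i, MeasurableSpace (U i)] [∀ i, MeasurableSpace (Y i)]

theorem measurable_piKernel (M : ∀ i, GMDP (X i) (U i) (Y i)) :
    Measurable fun p : (∀ i, X i) × (∀ i, U i) =>
      Measure.pi fun i => (M i).kernel (p.1 i, p.2 i) := by
  refine Measurable.measure_of_isPiSystem_of_isProbabilityMeasure generateFrom_pi.symm
    isPiSystem_pi ?_
  rintro _ ⟨s, hs, rfl⟩
  simp only [Measure.pi_pi]
  refine Finset.measurable_prod _ fun i _ => ?_
  exact (Kernel.measurable_coe (M i).kernel (hs i (Set.mem_univ i))).comp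
    (((measurable_pi_apply i).comp measurable_fst).prodMk
      ((measurable_pi_apply i).comp measurable_snd))

/-- The multi-agent system: the Cartesian composition of the agents. -/
noncomputable def compose (M : ∀ i, GMDP (X i) (U i) (Y i)) :
    GMDP (∀ i, X i) (∀ i, U i) (∀ i, Y i) where
  init i := (M i).init
  kernel := ⟨fun p => Measure.pi fun i => (M i).kernel (p.1 i, p.2 i), measurable_piKernel M⟩
  markov := ⟨fun p => inferInstanceAs
    (IsProbabilityMeasure (Measure.pi fun i => (M i).kernel (p.1 i, p.2 i)))⟩
  out x i := (M i).out (x i)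
  measurable_out := measurable_pi_lambda _ fun i =>
    (M i).measurable_out.comp (measurable_pi_apply i)

/-- The labelling `L(y) = ⋃ i, L^i(y_i)` of the multi-agent system, the atomic propositions
of distinct agents being disjoint. -/
def jointLabel (L : ∀ i, Y i → Set (AP i)) (y : ∀ i, Y i) : Set (Σ i, AP i) :=
  ⋃ i, Sigma.mk i '' L i (y i)

theorem measurable_jointLabel {L : ∀ i, Y i → Set (AP i)} (hL : ∀ i, Measurable (L i)) :
    Measurable (jointLabel L) := by
  refine measurable_set_iff.2 fun a => ?_
  have h : (fun y => a ∈ jointLabel L y) = fun y => a.2 ∈ L a.1 (y a.1) := by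
    funext y
    obtain ⟨i, p⟩ := a
    refine propext ⟨fun h => ?_, fun h => Set.mem_iUnion.2 ⟨i, p, h, rfl⟩⟩
    obtain ⟨j, p', hp', he⟩ := Set.mem_iUnion.1 h
    cases he
    exact hp'
  rw [h]
  exact (measurable_set_iff.1 (hL a.1) a.2).comp (measurable_pi_apply a.1)

end MultiAgent

end GMDP

/-! The proof is a coupling argument. The value function at the initial state is the satisfaction
probability of the abstract system under the policy: the conditional satisfaction probability given
the path up to time `n` has constant expectation in `n`, and it runs from the value function at `n =
0` to the indicator of satisfaction at `n = T` (`lintegral_condValue_succ`, `value_init_eq`).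

Run both systems jointly through the lifting `W`. Since `ε = 0`, related states emit the same
letters. If the abstract path satisfies the specification and the concrete one does not, the pair
must leave the relation at a first time `h` with `1 ≤ h ≤ T`; the words agree before `h`, so the
abstract hitting time is at least `h` (`exists_escape`). The event that the hitting time is at least
`h` and the pair is related at `h - 1` belongs to the past, and the next transition leaves the
relation with probability at most `δ`. Hence escape at `h` costs at most `δ * P(H ≥ h)`, and a union
bound gives the sum.

It remains to realise the coupling by a strategy for the concrete system, although `W` draws both
successors at once. In `gluedSystem` the interface draws `u`, the concrete system moves by its own
kernel, and the abstract successor is drawn from `W` conditioned on the concrete one. Averaging over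
`u` gives back `W`, while the concrete component has the right transitions given the whole joint
past. Its marginal law is therefore a closed loop, the strategy being the conditional law of the
action given the concrete history (`exists_eq_closedLoop`).

For a fixed horizon only finitely many decisions matter. Each is a function of the history and a
uniform seed, and some value of the seed does at least as well as the average. Agentwise simulations
are reduced to the joint one by taking products. -/

/-! ### Laws of paths determined by their one-step transitions. -/

section Path

variable {Z : Type*}

/-- The restriction of a path to the times `≤ n`. -/
def pathHist (n : ℕ) (ω : ℕ → Z) : Finset.Iic n → Z := fun i => ω i

/-- The path that follows the finite history `h` up to time `n` and is equal to `z` afterwards. -/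
def histGlue (n : ℕ) (p : (Finset.Iic n → Z) × Z) : ℕ → Z :=
  fun k => if hk : k ∈ Finset.Iic n then p.1 ⟨k, hk⟩ else p.2

/-- The path that follows `ω` up to time `n` and is equal to `z` afterwards. -/
def pathGlue (n : ℕ) (ω : ℕ → Z) (z : Z) : ℕ → Z := fun k => if k ≤ n then ω k else z

theorem histGlue_pathHist (n : ℕ) (ω : ℕ → Z) (z : Z) :
    histGlue n (pathHist n ω, z) = pathGlue n ω z := by
  funext k
  by_cases hk : k ≤ n <;> simp [histGlue, pathGlue, pathHist, hk]

theorem pathGlue_of_le {n k : ℕ} (hk : k ≤ n) (ω : ℕ → Z) (z : Z) : pathGlue n ω z k = ω k :=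
  if_pos hk

theorem pathGlue_of_lt {n k : ℕ} (hk : n < k) (ω : ℕ → Z) (z : Z) : pathGlue n ω z k = z :=
  if_neg (not_le.2 hk)

variable [MeasurableSpace Z]

@[fun_prop]
theorem measurable_pathHist (n : ℕ) : Measurable (pathHist (Z := Z) n) :=
  measurable_pi_lambda _ fun _ => measurable_pi_apply _

@[fun_prop]
theorem measurable_histGlue (n : ℕ) : Measurable (histGlue (Z := Z) n) := by
  refine measurable_pi_lambda _ fun k => ?_
  by_cases hk : k ∈ Finset.Iic n
  · simp only [histGlue, hk, dite_true]
    fun_prop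
  · simp only [histGlue, hk, dite_false]
    fun_prop

@[fun_prop]
theorem Measurable.pathGlue {A : Type*} [MeasurableSpace A] {f : A → ℕ → Z} {g : A → Z}
    (hf : Measurable f) (hg : Measurable g) (n : ℕ) :
    Measurable fun a => pathGlue n (f a) (g a) := by
  refine measurable_pi_lambda _ fun k => ?_
  by_cases hk : k ≤ n <;> simp only [_root_.pathGlue, hk, if_true, if_false] <;> fun_prop

/-- Restricted to times `≤ 0` the trajectory kernel is the identity, so only the identification of
`Z` with one-point histories is left, and it cancels. -/
theorem map_trajMeasure_zero (μ₀ : Measure Z) [IsProbabilityMeasure μ₀]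
    (κ : (n : ℕ) → Kernel (Finset.Iic n → Z) Z) [∀ n, IsMarkovKernel (κ n)] :
    (Kernel.trajMeasure (X := fun _ => Z) μ₀ κ).map (fun ω => ω 0) = μ₀ := by
  have e : (fun ω : ℕ → Z => ω 0) = (MeasurableEquiv.piUnique (fun _ : Finset.Iic 0 => Z)) ∘
      Preorder.frestrictLe (π := fun _ => Z) 0 := rfl
  rw [e, ← Measure.map_map (MeasurableEquiv.measurable _) (by fun_prop), Kernel.trajMeasure,
    Measure.map_comp _ _ (by fun_prop), Kernel.traj_map_frestrictLe, Kernel.partialTraj_self,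
    Measure.id_comp, Measure.map_map (MeasurableEquiv.measurable _) (MeasurableEquiv.measurable _),
    MeasurableEquiv.self_comp_symm, Measure.map_id]

/-- A measure on the paths is determined by the law at time `0` and the laws of the pairs
(history up to time `n`, value at time `n + 1`). -/
theorem eq_trajMeasure {μ₀ : Measure Z} [IsProbabilityMeasure μ₀]
    {κ : (n : ℕ) → Kernel (Finset.Iic n → Z) Z} [∀ n, IsMarkovKernel (κ n)]
    {P : Measure (ℕ → Z)} [IsProbabilityMeasure P] (h0 : P.map (fun ω => ω 0) = μ₀)
    (hs : ∀ n, P.map (fun ω => (pathHist n ω, ω (n + 1))) = P.map (pathHist n) ⊗ₘ κ n) :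
    P = Kernel.trajMeasure (X := fun _ => Z) μ₀ κ := by
  set P' := Kernel.trajMeasure (X := fun _ => Z) μ₀ κ with hP'
  have key : ∀ n, P.map (pathHist n) = P'.map (pathHist n) := by
    intro n
    induction n with
    | zero =>
      have e : (pathHist 0 : (ℕ → Z) → _) =
        (MeasurableEquiv.piUnique (fun _ : Finset.Iic 0 => Z)).symm ∘ fun ω => ω 0 := by
        funext ω k
        obtain ⟨k, hk⟩ := k
        obtain rfl : k = 0 := by simpa using hk
        rfl
      have h0' : P'.map (fun ω => ω 0) = μ₀ := map_trajMeasure_zero μ₀ κ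
      rw [e, ← Measure.map_map (MeasurableEquiv.measurable _) (by fun_prop),
        ← Measure.map_map (MeasurableEquiv.measurable _) (by fun_prop), h0, h0']
    | succ n ih =>
      let g : (Finset.Iic n → Z) × Z → (Finset.Iic (n + 1) → Z) :=
        fun p => pathHist (n + 1) (histGlue n p)
      have hg : Measurable g := by fun_prop
      -- The glued path is constant after time `n`, but only its entry at `n + 1` is read here.
      have e : (pathHist (n + 1) : (ℕ → Z) → _) = g ∘ fun ω => (pathHist n ω, ω (n + 1)) := by
        funext ω k
        obtain ⟨k, hk⟩ := k
        simp only [g, Function.comp, histGlue_pathHist, pathHist, pathGlue]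
        split_ifs with h
        · rfl
        · have := Finset.mem_Iic.1 hk
          congr 1; omega
      have hs' := Kernel.map_frestrictLe_trajMeasure_compProd_eq_map_trajMeasure
        (X := fun _ => Z) (μ₀ := μ₀) (κ := κ) (a := n)
      rw [e, ← Measure.map_map hg (by fun_prop), ← Measure.map_map hg (by fun_prop), hs, ih]
      exact congrArg _ hs'
  -- Every finite set of times lies in an initial segment, so agreement on histories gives agreement
  -- of all finite-dimensional laws.
  have : IsProjectiveLimit P (fun I : Finset ℕ => P'.map (I.restrict (π := fun _ => Z))) := by
    intro I
    have hI : I ⊆ Finset.Iic (I.sup id) := fun k hk =>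
      Finset.mem_Iic.2 (Finset.le_sup (f := id) hk)
    have e : (I.restrict (π := fun _ => Z)) =
      Finset.restrict₂ (π := fun _ => Z) hI ∘ pathHist (I.sup id) := rfl
    have hm : Measurable (Finset.restrict₂ (π := fun _ => Z) hI) :=
      measurable_pi_lambda _ fun _ => measurable_pi_apply _
    change P.map _ = P'.map _
    rw [e, ← Measure.map_map hm (by fun_prop), ← Measure.map_map hm (by fun_prop), key]
  exact this.unique fun _ => rfl

end Path

/-! ### One-step formulas for the closed loop. -/

namespace GMDP

variable {X U Y : Type*} [MeasurableSpace X] [MeasurableSpace U] [MeasurableSpace Y]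

/-- The law of `(x[n+1], u[n+1])` given the history up to time `n`. -/
noncomputable def stepKernel (M : GMDP X U Y) (C : Strategy X U) (n : ℕ) :
    Kernel (Finset.Iic n → X × U) (X × U) :=
  (M.kernel.comap (fun h : Finset.Iic n → X × U => h ⟨n, Finset.mem_Iic.2 le_rfl⟩)
    (measurable_pi_apply _)) ⊗ₖ C.step n

instance (M : GMDP X U Y) (C : Strategy X U) (n : ℕ) : IsMarkovKernel (M.stepKernel C n) := by
  unfold stepKernel; infer_instance

instance (M : GMDP X U Y) (C : Strategy X U) : IsProbabilityMeasure (M.closedLoop C) := by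
  unfold closedLoop; infer_instance

theorem lintegral_stepKernel (M : GMDP X U Y) (C : Strategy X U) (n : ℕ)
    (h : Finset.Iic n → X × U) {f : X × U → ℝ≥0∞} (hf : Measurable f) :
    ∫⁻ z, f z ∂M.stepKernel C n h =
      ∫⁻ x, ∫⁻ u, f (x, u) ∂C.step n (h, x) ∂M.kernel (h ⟨n, Finset.mem_Iic.2 le_rfl⟩) := by
  rw [stepKernel, Kernel.lintegral_compProd _ _ _ hf, Kernel.comap_apply]

theorem map_zero_closedLoop (M : GMDP X U Y) (C : Strategy X U) :
    (M.closedLoop C).map (fun ω => ω 0) = Measure.dirac M.init ⊗ₘ C.init :=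
  map_trajMeasure_zero _ (M.stepKernel C)

theorem map_succ_closedLoop (M : GMDP X U Y) (C : Strategy X U) (n : ℕ) :
    (M.closedLoop C).map (fun ω => (pathHist n ω, ω (n + 1))) =
      (M.closedLoop C).map (pathHist n) ⊗ₘ M.stepKernel C n :=
  (Kernel.map_frestrictLe_trajMeasure_compProd_eq_map_trajMeasure (X := fun _ => X × U)
    (μ₀ := Measure.dirac M.init ⊗ₘ C.init) (κ := M.stepKernel C) (a := n)).symm

theorem lintegral_closedLoop_zero (M : GMDP X U Y) (C : Strategy X U) {f : X × U → ℝ≥0∞}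
    (hf : Measurable f) :
    ∫⁻ ω, f (ω 0) ∂M.closedLoop C = ∫⁻ u, f (M.init, u) ∂C.init M.init := by
  rw [← lintegral_map (g := fun ω : ℕ → X × U => ω 0) hf (by fun_prop), map_zero_closedLoop,
    Measure.lintegral_compProd hf, lintegral_dirac' _ hf.lintegral_kernel_prod_right']

theorem lintegral_closedLoop_hist (M : GMDP X U Y) (C : Strategy X U) (n : ℕ)
    {f : (Finset.Iic n → X × U) × (X × U) → ℝ≥0∞} (hf : Measurable f) :
    ∫⁻ ω, f (pathHist n ω, ω (n + 1)) ∂M.closedLoop C =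
      ∫⁻ ω, ∫⁻ x, ∫⁻ u, f (pathHist n ω, (x, u)) ∂C.step n (pathHist n ω, x) ∂M.kernel (ω n)
        ∂M.closedLoop C := by
  rw [← lintegral_map (g := fun ω : ℕ → X × U => (pathHist n ω, ω (n + 1))) hf (by fun_prop),
    map_succ_closedLoop, Measure.lintegral_compProd hf,
    lintegral_map hf.lintegral_kernel_prod_right' (by fun_prop)]
  refine lintegral_congr fun ω => ?_
  rw [lintegral_stepKernel _ _ _ _ (by fun_prop)]
  rfl

/-- The one-step formula for functionals of the path up to time `n + 1`. -/
theorem lintegral_closedLoop_succ (M : GMDP X U Y) (C : Strategy X U) (n : ℕ)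
    {f : (ℕ → X × U) → ℝ≥0∞} (hf : Measurable f) :
    ∫⁻ ω, f (pathGlue n ω (ω (n + 1))) ∂M.closedLoop C =
      ∫⁻ ω, ∫⁻ x, ∫⁻ u, f (pathGlue n ω (x, u)) ∂C.step n (pathHist n ω, x) ∂M.kernel (ω n)
        ∂M.closedLoop C := by
  simpa only [histGlue_pathHist] using
    M.lintegral_closedLoop_hist C n (f := fun p => f (histGlue n p)) (by fun_prop)

/-- The law of the closed loop is characterised by its one-step formulas. -/
theorem eq_closedLoop (M : GMDP X U Y) (C : Strategy X U) {P : Measure (ℕ → X × U)}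
    [IsProbabilityMeasure P]
    (h0 : ∀ f : X × U → ℝ≥0∞, Measurable f →
      ∫⁻ ω, f (ω 0) ∂P = ∫⁻ u, f (M.init, u) ∂C.init M.init)
    (hs : ∀ n, ∀ f : (Finset.Iic n → X × U) × (X × U) → ℝ≥0∞, Measurable f →
      ∫⁻ ω, f (pathHist n ω, ω (n + 1)) ∂P =
        ∫⁻ ω, ∫⁻ x, ∫⁻ u, f (pathHist n ω, (x, u)) ∂C.step n (pathHist n ω, x) ∂M.kernel (ω n)
          ∂P) :
    P = M.closedLoop C := by
  refine eq_trajMeasure (κ := M.stepKernel C) ?_ fun n => ?_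
  · refine Measure.ext_of_lintegral _ fun f hf => ?_
    rw [lintegral_map hf (by fun_prop), h0 f hf, Measure.lintegral_compProd hf,
      lintegral_dirac' _ hf.lintegral_kernel_prod_right']
  · refine Measure.ext_of_lintegral _ fun f hf => ?_
    rw [lintegral_map hf (by fun_prop), hs n f hf, Measure.lintegral_compProd hf,
      lintegral_map hf.lintegral_kernel_prod_right' (by fun_prop)]
    refine lintegral_congr fun ω => ?_
    rw [lintegral_stepKernel _ _ _ _ (by fun_prop)]
    rfl

end GMDP

/-! ### Conditioning on the action at a given time. -/

namespace Strategy

variable {X U : Type*} [MeasurableSpace X] [MeasurableSpace U]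

/-- The law of the action at time `n`, as a kernel on the paths. -/
noncomputable def act (C : Strategy X U) : ℕ → Kernel (ℕ → X × U) U
  | 0 => C.init.comap (fun ω => (ω 0).1) (by fun_prop)
  | n + 1 => (C.step n).comap (fun ω => (pathHist n ω, (ω (n + 1)).1)) (by fun_prop)

instance (C : Strategy X U) (n : ℕ) : IsMarkovKernel (C.act n) := by
  cases n <;> unfold act <;> infer_instance

end Strategy

section SetAction

variable {X U : Type*}

/-- The path `ω` up to the state at time `n`, with the action at time `n` replaced by `u`. -/
def setAction (n : ℕ) (ω : ℕ → X × U) (u : U) : ℕ → X × U :=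
  fun k => if k < n then ω k else ((ω n).1, u)

theorem setAction_zero (ω : ℕ → X × U) (u : U) : setAction 0 ω u = fun _ => ((ω 0).1, u) := by
  funext k; simp [setAction]

theorem setAction_succ (n : ℕ) (ω : ℕ → X × U) (u : U) :
    setAction (n + 1) ω u = pathGlue n ω ((ω (n + 1)).1, u) := by
  funext k; simp [setAction, pathGlue]

/-- Reinserting the actual action changes nothing up to time `n`. A functional of the path up to `n`
can thus be written through `setAction`, after which the action can be integrated out. -/
theorem setAction_self (n : ℕ) (ω : ℕ → X × U) :
    setAction n ω (ω n).2 = pathGlue n ω (ω n) := by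
  funext k
  rcases lt_trichotomy k n with h | rfl | h
  · simp [setAction, pathGlue, h, h.le]
  · simp [setAction, pathGlue]
  · simp [setAction, pathGlue, h.not_gt, h.not_ge]

@[fun_prop]
theorem Measurable.setAction {A : Type*} [MeasurableSpace A] [MeasurableSpace X]
    [MeasurableSpace U] {f : A → ℕ → X × U} {g : A → U} (hf : Measurable f) (hg : Measurable g)
    (n : ℕ) : Measurable fun a => setAction n (f a) (g a) := by
  cases n
  · simp only [setAction_zero]; fun_prop
  · simp only [setAction_succ]; fun_prop

end SetAction

namespace GMDP

variable {X U Y : Type*} [MeasurableSpace X] [MeasurableSpace U] [MeasurableSpace Y]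

/-- The action at time `n` has the law prescribed by the strategy, given the past. -/
theorem lintegral_closedLoop_setAction (M : GMDP X U Y) (C : Strategy X U) (n : ℕ)
    {f : (ℕ → X × U) → ℝ≥0∞} (hf : Measurable f) :
    ∫⁻ ω, f (setAction n ω (ω n).2) ∂M.closedLoop C =
      ∫⁻ ω, ∫⁻ u, f (setAction n ω u) ∂C.act n ω ∂M.closedLoop C := by
  cases n with
  | zero =>
    simp only [setAction_zero, Strategy.act, Kernel.comap_apply]
    rw [M.lintegral_closedLoop_zero C (f := fun z => f fun _ => z) (by fun_prop),
      M.lintegral_closedLoop_zero C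
        (f := fun z => ∫⁻ u, f (fun _ => (z.1, u)) ∂C.init z.1)]
    · simp
    · have h : Measurable fun p : X × U => f fun _ => (p.1, p.2) := by fun_prop
      exact h.lintegral_kernel_prod_right'.comp measurable_fst
  | succ n =>
    simp only [setAction_succ, Strategy.act, Kernel.comap_apply]
    have hg : Measurable fun p : (Finset.Iic n → X × U) × (X × U) =>
        ∫⁻ u, f (histGlue n (p.1, (p.2.1, u))) ∂C.step n (p.1, p.2.1) := by
      have h : Measurable fun p : ((Finset.Iic n → X × U) × X) × U =>
        f (histGlue n (p.1.1, (p.1.2, p.2))) := by fun_prop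
      exact h.lintegral_kernel_prod_right'.comp
        (measurable_fst.prodMk (measurable_fst.comp measurable_snd))
    have := M.lintegral_closedLoop_hist C n hg
    simp only [histGlue_pathHist] at this
    rw [this, M.lintegral_closedLoop_succ C n hf]
    simp

end GMDP

/-! ### Strategies as conditional laws, and derandomisation. -/

namespace GMDP

variable {X U Y : Type*} [MeasurableSpace X] [MeasurableSpace U] [MeasurableSpace Y]

/-- A law of paths with the right transition probabilities is the law of the closed loop with some
control strategy. -/
theorem exists_eq_closedLoop [StandardBorelSpace U] (M : GMDP X U Y) {P : Measure (ℕ → X × U)}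
    [IsProbabilityMeasure P] (h0 : P.map (fun ω => (ω 0).1) = Measure.dirac M.init)
    (hs : ∀ n, ∀ f : (Finset.Iic n → X × U) × X → ℝ≥0∞, Measurable f →
      ∫⁻ ω, f (pathHist n ω, (ω (n + 1)).1) ∂P =
        ∫⁻ ω, ∫⁻ x, f (pathHist n ω, x) ∂M.kernel (ω n) ∂P) :
    ∃ C : Strategy X U, P = M.closedLoop C := by
  have hne : Nonempty U := by
    obtain ⟨ω⟩ := nonempty_of_isProbabilityMeasure P
    exact ⟨(ω 0).2⟩
  -- The strategy is the regular conditional law of the action given the past and the current state;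
  -- it exists because `U` is standard Borel.
  let C : Strategy X U :=
    { init := condDistrib (fun ω : ℕ → X × U => (ω 0).2) (fun ω => (ω 0).1) P
      step := fun n => condDistrib (fun ω : ℕ → X × U => (ω (n + 1)).2)
        (fun ω => (pathHist n ω, (ω (n + 1)).1)) P
      markov_init := inferInstance
      markov_step := fun _ => inferInstance }
  refine ⟨C, M.eq_closedLoop C (fun f hf => ?_) fun n f hf => ?_⟩
  · have h := compProd_map_condDistrib (μ := P) (mβ := ‹MeasurableSpace X›)
      (X := fun ω : ℕ → X × U => (ω 0).1)
      (Y := fun ω : ℕ → X × U => (ω 0).2) (Measurable.aemeasurable (by fun_prop))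
    change ∫⁻ ω, f ((ω 0).1, (ω 0).2) ∂P = _
    rw [← lintegral_map (g := fun ω : ℕ → X × U => ((ω 0).1, (ω 0).2)) hf (by fun_prop), ← h,
      Measure.lintegral_compProd hf, h0, lintegral_dirac' _ hf.lintegral_kernel_prod_right']
  · have h := compProd_map_condDistrib (μ := P)
      (mβ := inferInstanceAs (MeasurableSpace ((Finset.Iic n → X × U) × X)))
      (X := fun ω : ℕ → X × U => (pathHist n ω, (ω (n + 1)).1))
      (Y := fun ω : ℕ → X × U => (ω (n + 1)).2) (Measurable.aemeasurable (by fun_prop))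
    have hg : Measurable fun p : ((Finset.Iic n → X × U) × X) × U =>
      f (p.1.1, (p.1.2, p.2)) := by fun_prop
    have e : ∫⁻ ω, f (pathHist n ω, ω (n + 1)) ∂P =
        ∫⁻ q, ∫⁻ u, f (q.1, (q.2, u)) ∂C.step n q
          ∂P.map (fun ω => (pathHist n ω, (ω (n + 1)).1)) := by
      rw [← Measure.lintegral_compProd (κ := C.step n) hg, h, lintegral_map hg (by fun_prop)]
    rw [e, lintegral_map hg.lintegral_kernel_prod_right' (by fun_prop),
      hs n _ hg.lintegral_kernel_prod_right']

/-- A randomised choice can be replaced by a measurable one without decreasing an expected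
reward. -/
theorem exists_measurable_lintegral_le {A : Type*} [MeasurableSpace A] [StandardBorelSpace U]
    [Nonempty U] (μ : Measure A) [IsProbabilityMeasure μ] (κ : Kernel A U) [IsMarkovKernel κ]
    {g : A × U → ℝ≥0∞} (hg : Measurable g) (hg1 : ∀ p, g p ≤ 1) :
    ∃ φ : A → U, Measurable φ ∧ ∫⁻ a, ∫⁻ u, g (a, u) ∂κ a ∂μ ≤ ∫⁻ a, g (a, φ a) ∂μ := by
  -- The kernel is realised as the law of `F a r` with `r` uniform on the unit interval. After
  -- exchanging the integrals, some fixed `r` reaches at least the average over `r`.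
  obtain ⟨F, hF, hκ⟩ := κ.exists_measurable_map_eq_unitInterval
  have hF' : ∀ a, Measurable (F a) := fun a => hF.comp measurable_prodMk_left
  have hFr : ∀ r, Measurable fun a => F a r := fun r => hF.comp measurable_prodMk_right
  have hG : Measurable fun p : A × unitInterval => g (p.1, F p.1 p.2) :=
    hg.comp (measurable_fst.prodMk hF)
  have e : ∫⁻ a, ∫⁻ u, g (a, u) ∂κ a ∂μ = ∫⁻ r, ∫⁻ a, g (a, F a r) ∂μ := by
    rw [← lintegral_lintegral_swap hG.aemeasurable]
    refine lintegral_congr fun a => ?_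
    rw [← hκ a, lintegral_map (by fun_prop) (hF' a)]
  have hfin : ∫⁻ r, ∫⁻ a, g (a, F a r) ∂μ ≠ ∞ := by
    refine ne_of_lt (lt_of_le_of_lt (lintegral_mono fun r => lintegral_mono fun a => hg1 _) ?_)
    simp
  obtain ⟨r, hr⟩ := exists_lintegral_le hfin
  exact ⟨fun a => F a r, hFr r, e ▸ hr⟩

/-- Functionals of the path up to time `T` only see the decisions before time `T`. -/
theorem lintegral_closedLoop_congr (M : GMDP X U Y) {C C' : Strategy X U}
    (h0 : C.init = C'.init) (T : ℕ) (hs : ∀ n < T, C.step n = C'.step n)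
    {f : (ℕ → X × U) → ℝ≥0∞} (hf : Measurable f)
    (hdep : ∀ ω ω', (∀ k ≤ T, ω k = ω' k) → f ω = f ω') :
    ∫⁻ ω, f ω ∂M.closedLoop C = ∫⁻ ω, f ω ∂M.closedLoop C' := by
  -- `C.step n` chooses the action at time `n + 1`, so a path up to time `T` involves `C.init` and
  -- `C.step n` for `n < T` only.
  induction T generalizing f with
  | zero =>
    have e : ∀ ω, f ω = f fun _ => ω 0 := fun ω => hdep _ _ fun k hk => by
      rw [Nat.le_zero.1 hk]
    rw [lintegral_congr (μ := M.closedLoop C) e, lintegral_congr (μ := M.closedLoop C') e]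
    rw [M.lintegral_closedLoop_zero C (f := fun z => f fun _ => z) (by fun_prop),
      M.lintegral_closedLoop_zero C' (f := fun z => f fun _ => z) (by fun_prop), h0]
  | succ T ih =>
    have e : ∀ ω, f ω = f (pathGlue T ω (ω (T + 1))) := fun ω => hdep _ _ fun k hk => by
      rcases Nat.le_succ_iff.1 hk with h | rfl
      · rw [pathGlue_of_le h]
      · rw [pathGlue_of_lt T.lt_succ_self]
    rw [lintegral_congr (μ := M.closedLoop C) e, lintegral_congr (μ := M.closedLoop C') e]
    rw [M.lintegral_closedLoop_succ C T hf, M.lintegral_closedLoop_succ C' T hf,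
      hs T T.lt_succ_self]
    refine ih (fun n hn => hs n (hn.trans T.lt_succ_self)) ?_ fun ω ω' h => ?_
    · have h : Measurable fun p : ((Finset.Iic T → X × U) × X) × U =>
        f (histGlue T (p.1.1, (p.1.2, p.2))) := by fun_prop
      have hG := (h.lintegral_kernel_prod_right' (κ := C'.step T)).lintegral_kernel_prod_right'
        (κ := M.kernel.comap (fun h : Finset.Iic T → X × U => h ⟨T, Finset.mem_Iic.2 le_rfl⟩)
          (measurable_pi_apply _))
      simpa only [Function.comp_def, histGlue_pathHist] using! hG.comp (measurable_pathHist T)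
    · have h1 : pathHist T ω = pathHist T ω' := funext fun k => h k (Finset.mem_Iic.1 k.2)
      simp only [← histGlue_pathHist, h1, h T le_rfl]

/-- The expected reward of a randomised strategy over a finite horizon is not larger than that of
some deterministic strategy. -/
theorem exists_isDeterministic_lintegral_le [StandardBorelSpace U] [Nonempty U]
    (M : GMDP X U Y) (C : Strategy X U) (T : ℕ) {f : (ℕ → X × U) → ℝ≥0∞} (hf : Measurable f)
    (hf1 : ∀ ω, f ω ≤ 1) (hdep : ∀ ω ω', (∀ k ≤ T, ω k = ω' k) → f ω = f ω') :
    ∃ C' : Strategy X U, C'.IsDeterministic ∧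
      ∫⁻ ω, f ω ∂M.closedLoop C ≤ ∫⁻ ω, f ω ∂M.closedLoop C' := by
  induction T generalizing f with
  | zero =>
    have e : ∀ ω, f ω = f fun _ => ω 0 := fun ω => hdep _ _ fun k hk => by
      rw [Nat.le_zero.1 hk]
    have hg : Measurable fun z : X × U => f fun _ => z := by fun_prop
    obtain ⟨φ, hφ, hle⟩ := exists_measurable_lintegral_le (Measure.dirac M.init) C.init hg
      fun _ => hf1 _
    -- Actions after time `0` do not affect the reward, so any constant will do.
    obtain ⟨u₀⟩ := ‹Nonempty U›
    refine ⟨{ init := Kernel.deterministic φ hφ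
              step := fun _ => Kernel.deterministic (fun _ => u₀) measurable_const
              markov_init := inferInstance
              markov_step := fun _ => inferInstance },
      ⟨⟨φ, hφ, rfl⟩, fun _ => ⟨_, measurable_const, rfl⟩⟩, ?_⟩
    rw [lintegral_congr e, lintegral_congr (μ := M.closedLoop _) e]
    rw [M.lintegral_closedLoop_zero _ hg, M.lintegral_closedLoop_zero _ hg,
      Kernel.lintegral_deterministic' (f := fun u => f fun _ => (M.init, u)) hφ
        (hg.comp measurable_prodMk_left)]
    rwa [lintegral_dirac' _ hg.lintegral_kernel_prod_right',
      lintegral_dirac' _ (by fun_prop)] at hle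
  | succ T ih =>
    have e : ∀ ω, f ω = f (pathGlue T ω (ω (T + 1))) := fun ω => hdep _ _ fun k hk => by
      rcases Nat.le_succ_iff.1 hk with h | rfl
      · rw [pathGlue_of_le h]
      · rw [pathGlue_of_lt T.lt_succ_self]
    let η : Kernel (Finset.Iic T → X × U) X := M.kernel.comap
      (fun h => h ⟨T, Finset.mem_Iic.2 le_rfl⟩) (measurable_pi_apply _)
    have hF : Measurable fun p : ((Finset.Iic T → X × U) × X) × U =>
      f (histGlue T (p.1.1, (p.1.2, p.2))) := by fun_prop
    have hG : Measurable fun h : Finset.Iic T → X × U =>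
        ∫⁻ x, ∫⁻ u, f (histGlue T (h, (x, u))) ∂C.step T (h, x) ∂η h :=
      hF.lintegral_kernel_prod_right'.lintegral_kernel_prod_right'
    -- The last decision, still randomised as in `C`, is averaged into a reward on paths up to time
    -- `T`, to which the induction hypothesis applies.
    let g : (ℕ → X × U) → ℝ≥0∞ := fun ω =>
      ∫⁻ x, ∫⁻ u, f (histGlue T (pathHist T ω, (x, u))) ∂C.step T (pathHist T ω, x)
        ∂η (pathHist T ω)
    have hg : Measurable g := hG.comp (measurable_pathHist T)
    have eC : ∫⁻ ω, f ω ∂M.closedLoop C = ∫⁻ ω, g ω ∂M.closedLoop C := by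
      rw [lintegral_congr e]
      rw [M.lintegral_closedLoop_succ C T hf]
      simp only [g, histGlue_pathHist]
      rfl
    obtain ⟨C', ⟨h0', hs'⟩, hle⟩ := ih hg
      (fun ω => by
        calc g ω ≤ ∫⁻ x, ∫⁻ u, 1 ∂C.step T (pathHist T ω, x) ∂η (pathHist T ω) :=
              lintegral_mono fun x => lintegral_mono fun u => hf1 _
          _ ≤ 1 := by simp)
      fun ω ω' h => by
        have h1 : pathHist T ω = pathHist T ω' := funext fun k => h k (Finset.mem_Iic.1 k.2)
        simp only [g, h1]
    have : IsProbabilityMeasure ((M.closedLoop C').map (pathHist T)) :=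
      Measure.isProbabilityMeasure_map (by fun_prop)
    -- The last decision is derandomised under the law of the history produced by the already
    -- deterministic `C'`, not by `C`.
    obtain ⟨φ, hφ, hle'⟩ := exists_measurable_lintegral_le
      ((M.closedLoop C').map (pathHist T) ⊗ₘ η) (C.step T) hF fun _ => hf1 _
    let C'' : Strategy X U :=
      { init := C'.init
        step := Function.update C'.step T (Kernel.deterministic φ hφ)
        markov_init := inferInstance
        markov_step := fun n => by
          rcases eq_or_ne n T with rfl | h
          · rw [Function.update_self]; infer_instance
          · rw [Function.update_of_ne h]; infer_instance }
    refine ⟨C'', ⟨h0', fun n => ?_⟩, ?_⟩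
    · rcases eq_or_ne n T with rfl | h
      · exact ⟨φ, hφ, Function.update_self ..⟩
      · obtain ⟨ψ, hψ, hn⟩ := hs' n
        exact ⟨ψ, hψ, (Function.update_of_ne h ..).trans hn⟩
    · have hφF : Measurable fun p : (Finset.Iic T → X × U) × X =>
        f (histGlue T (p.1, (p.2, φ p))) := by fun_prop
      rw [Measure.lintegral_compProd hF.lintegral_kernel_prod_right',
        Measure.lintegral_compProd hφF, lintegral_map hG (by fun_prop),
        lintegral_map hφF.lintegral_kernel_prod_right' (by fun_prop)] at hle'
      rw [eC]
      refine (hle.trans hle').trans (le_of_eq ?_)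
      have hstep : C''.step T = Kernel.deterministic φ hφ := Function.update_self ..
      rw [lintegral_congr e]
      rw [M.lintegral_closedLoop_succ C'' T hf, hstep]
      have e2 : ∀ ω : ℕ → X × U, ∫⁻ x, ∫⁻ u, f (pathGlue T ω (x, u))
          ∂Kernel.deterministic φ hφ (pathHist T ω, x) ∂M.kernel (ω T) =
          ∫⁻ x, f (histGlue T (pathHist T ω, (x, φ (pathHist T ω, x)))) ∂η (pathHist T ω) := by
        intro ω
        refine lintegral_congr fun x => ?_
        rw [Kernel.lintegral_deterministic' hφ (by fun_prop), histGlue_pathHist]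
      have hm : Measurable fun ω : ℕ → X × U =>
          ∫⁻ x, f (histGlue T (pathHist T ω, (x, φ (pathHist T ω, x)))) ∂η (pathHist T ω) :=
        hφF.lintegral_kernel_prod_right'.comp (measurable_pathHist T)
      rw [lintegral_congr e2]
      -- The integrand sees the path only up to time `T`, whose law is unaffected by changing `step
      -- T`.
      refine M.lintegral_closedLoop_congr (C := C') (C' := C'') rfl T (fun n hn => ?_) hm
        fun ω ω' h => ?_
      · exact (Function.update_of_ne hn.ne ..).symm
      · have h1 : pathHist T ω = pathHist T ω' := funext fun k => h k (Finset.mem_Iic.1 k.2)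
        simp only [h1]

end GMDP

/-! ### Automaton runs and hitting times. -/

namespace DFA

variable {α Q : Type*}

theorem run_congr (𝒜 : DFA α Q) {l l' : ℕ → α} {t : ℕ} (h : ∀ k < t, l k = l' k) :
    𝒜.run l t = 𝒜.run l' t := by
  induction t with
  | zero => rfl
  | succ t ih =>
    simp only [run, ih fun k hk => h k (hk.trans t.lt_succ_self), h t t.lt_succ_self]

theorem le_hittingTime_iff (𝒜 : DFA α Q) {l : ℕ → α} {h : ℕ} :
    (h : ℕ∞) ≤ 𝒜.hittingTime l ↔ ∀ t < h, 𝒜.run l (t + 1) ∉ 𝒜.accept := by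
  simp only [hittingTime, le_iInf_iff, Nat.cast_le]
  exact forall_congr' fun t => ⟨fun H ht hm => ht.not_ge (H hm), fun H hm => by
    by_contra hlt
    exact H (not_le.1 hlt) hm⟩

variable {Ω : Type*} [MeasurableSpace Ω] [Finite α] [MeasurableSpace α]
  [DiscreteMeasurableSpace α] [Finite Q] [MeasurableSpace Q] [DiscreteMeasurableSpace Q]

theorem measurableSet_run_mem (𝒜 : DFA α Q) {l : Ω → ℕ → α} (hl : ∀ k, Measurable fun ω => l ω k)
    (t : ℕ) (S : Set Q) : MeasurableSet {ω | 𝒜.run (l ω) t ∈ S} :=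
  𝒜.measurable_run hl t (MeasurableSet.of_discrete (s := S))

theorem measurableSet_exists_lt (𝒜 : DFA α Q) {l : Ω → ℕ → α}
    (hl : ∀ k, Measurable fun ω => l ω k) (n : ℕ) :
    MeasurableSet {ω | ∃ t < n, 𝒜.run (l ω) (t + 1) ∈ 𝒜.accept} := by
  simp only [Set.ofPred_exists, Set.ofPred_and]
  exact MeasurableSet.iUnion fun t => (MeasurableSet.const _).inter (𝒜.measurableSet_run_mem hl _ _)

theorem measurableSet_satisfies (𝒜 : DFA α Q) {l : Ω → ℕ → α}
    (hl : ∀ k, Measurable fun ω => l ω k) (T : ℕ) : MeasurableSet {ω | 𝒜.Satisfies T (l ω)} := by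
  simpa only [Satisfies, Nat.lt_succ_iff] using 𝒜.measurableSet_exists_lt hl (T + 1)

theorem measurableSet_le_hittingTime (𝒜 : DFA α Q) {l : Ω → ℕ → α}
    (hl : ∀ k, Measurable fun ω => l ω k) (h : ℕ) :
    MeasurableSet {ω | (h : ℕ∞) ≤ 𝒜.hittingTime (l ω)} := by
  convert (𝒜.measurableSet_exists_lt hl h).compl using 1
  ext ω
  simp [le_hittingTime_iff]

end DFA

/-! ### Value functions as satisfaction probabilities. -/

namespace GMDP

variable {X U Y α Q : Type*} [MeasurableSpace X] [MeasurableSpace U] [MeasurableSpace Y]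

theorem value_of_mem [MeasurableSpace Q] (M : GMDP X U Y) (𝒜 : DFA α Q) (L : Y → α)
    (π : MarkovPolicy X Q U) (T t : ℕ) {q : Q} (hq : q ∈ 𝒜.accept) (x : X) :
    M.value 𝒜 L π T t q x = 1 := by
  cases t <;> simp [value, hq]

theorem value_succ_of_notMem [MeasurableSpace Q] (M : GMDP X U Y) (𝒜 : DFA α Q)
    (L : Y → α) (π : MarkovPolicy X Q U) (T t : ℕ) {q : Q} (hq : q ∉ 𝒜.accept) (x : X) :
    M.value 𝒜 L π T (t + 1) q x =
      ∫⁻ x', M.value 𝒜 L π T t (𝒜.step q (L (M.out x'))) x'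
        ∂(M.kernel (x, π.act (T - 1 - t) (x, q))) := by
  simp [value, hq]

open Classical in
/-- The conditional probability of satisfaction within the horizon `T`, given the path up to
time `n`. -/
noncomputable def condValue [MeasurableSpace Q] (M : GMDP X U Y) (𝒜 : DFA α Q) (L : Y → α)
    (π : MarkovPolicy X Q U) (T n : ℕ) (ω : ℕ → X × U) : ℝ≥0∞ :=
  if ∃ t < n, 𝒜.run (M.word L ω) (t + 1) ∈ 𝒜.accept then 1
  else M.value 𝒜 L π T (T - n) (𝒜.run (M.word L ω) (n + 1)) (ω n).1

/-- Letters come from states, so actions are invisible here; this allows the newest action to be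
replaced by a placeholder. -/
theorem condValue_congr [MeasurableSpace Q] (M : GMDP X U Y) (𝒜 : DFA α Q) (L : Y → α)
    (π : MarkovPolicy X Q U) (T n : ℕ) {ω ω' : ℕ → X × U} (h : ∀ k ≤ n, (ω k).1 = (ω' k).1) :
    M.condValue 𝒜 L π T n ω = M.condValue 𝒜 L π T n ω' := by
  have hr : ∀ t ≤ n, 𝒜.run (M.word L ω) (t + 1) = 𝒜.run (M.word L ω') (t + 1) := fun t ht =>
    𝒜.run_congr fun k hk => by simp only [word, h k (by omega)]
  have hex : (∃ t < n, 𝒜.run (M.word L ω) (t + 1) ∈ 𝒜.accept) ↔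
      ∃ t < n, 𝒜.run (M.word L ω') (t + 1) ∈ 𝒜.accept :=
    exists_congr fun t => and_congr_right fun ht => by rw [hr t ht.le]
  unfold condValue
  rw [hr n le_rfl, h n le_rfl]
  by_cases hc : ∃ t < n, 𝒜.run (M.word L ω) (t + 1) ∈ 𝒜.accept
  · rw [if_pos hc, if_pos (hex.1 hc)]
  · rw [if_neg hc, if_neg (mt hex.2 hc)]

variable [MeasurableSpace α]

theorem measurable_word (M : GMDP X U Y) {L : Y → α} (hL : Measurable L) (k : ℕ) :
    Measurable fun ω : ℕ → X × U => M.word L ω k :=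
  hL.comp (M.measurable_out.comp (measurable_fst.comp (measurable_pi_apply k)))

variable [Finite α] [DiscreteMeasurableSpace α] [Finite Q] [MeasurableSpace Q]
  [DiscreteMeasurableSpace Q]

theorem act_policyStrategy (M : GMDP X U Y) (𝒜 : DFA α Q) {L : Y → α} (hL : Measurable L)
    (π : MarkovPolicy X Q U) (n : ℕ) (ω : ℕ → X × U) :
    (M.policyStrategy 𝒜 hL π).act n ω =
      Measure.dirac (π.act n ((ω n).1, 𝒜.run (M.word L ω) (n + 1))) := by
  cases n with
  | zero => rfl
  | succ n =>
    have h : 𝒜.run (M.histWord L n (pathHist n ω, (ω (n + 1)).1)) (n + 2) =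
        𝒜.run (M.word L ω) (n + 2) := by
      refine 𝒜.run_congr fun k hk => ?_
      by_cases hkn : k ≤ n
      · simp [histWord, word, hkn, pathHist]
      · obtain rfl : k = n + 1 := by omega
        simp [histWord, word]
    rw [← h]
    rfl

theorem measurable_value (M : GMDP X U Y) (𝒜 : DFA α Q) {L : Y → α} (hL : Measurable L)
    (π : MarkovPolicy X Q U) (T t : ℕ) :
    Measurable fun p : Q × X => M.value 𝒜 L π T t p.1 p.2 := by
  induction t with
  | zero =>
    exact (Measurable.of_discrete (f := 𝒜.accept.indicator (1 : Q → ℝ≥0∞))).comp measurable_fst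
  | succ t ih =>
    have h1 (S : Set Q) : Measurable fun p : Q × X => S.indicator (1 : Q → ℝ≥0∞) p.1 :=
      (Measurable.of_discrete (f := S.indicator (1 : Q → ℝ≥0∞))).comp measurable_fst
    have hstep : Measurable fun p : Q × α => 𝒜.step p.1 p.2 := Measurable.of_discrete
    have h2 : Measurable fun p : (Q × X) × X =>
        M.value 𝒜 L π T t (𝒜.step p.1.1 (L (M.out p.2))) p.2 :=
      ih.comp ((hstep.comp ((measurable_fst.comp measurable_fst).prodMk
        (hL.comp (M.measurable_out.comp measurable_snd)))).prodMk measurable_snd)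
    have h3 : Measurable fun p : Q × X => (p.2, π.act (T - 1 - t) (p.2, p.1)) :=
      measurable_snd.prodMk ((π.measurable_act _).comp measurable_swap)
    exact (h1 _).add ((h1 _).mul
      (h2.lintegral_kernel_prod_right' (κ := M.kernel.comap _ h3)))

theorem measurable_condValue (M : GMDP X U Y) (𝒜 : DFA α Q) {L : Y → α} (hL : Measurable L)
    (π : MarkovPolicy X Q U) (T n : ℕ) : Measurable (M.condValue 𝒜 L π T n) :=
  Measurable.ite (𝒜.measurableSet_exists_lt (M.measurable_word hL) n) measurable_const
    ((M.measurable_value 𝒜 hL π T (T - n)).comp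
      ((𝒜.measurable_run (M.measurable_word hL) (n + 1)).prodMk
        (measurable_fst.comp (measurable_pi_apply n))))

-- This is the martingale property in expectation. The accepting state need not be absorbing for the
-- automaton, whereas the value recursion stops there; hence `condValue` records past acceptance
-- separately.
open Classical in
theorem lintegral_condValue_succ (M : GMDP X U Y) (𝒜 : DFA α Q) {L : Y → α} (hL : Measurable L)
    (π : MarkovPolicy X Q U) {T n : ℕ} (hn : n < T) :
    ∫⁻ ω, M.condValue 𝒜 L π T (n + 1) ω ∂M.closedLoop (M.policyStrategy 𝒜 hL π) =
      ∫⁻ ω, M.condValue 𝒜 L π T n ω ∂M.closedLoop (M.policyStrategy 𝒜 hL π) := by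
  set P := M.closedLoop (M.policyStrategy 𝒜 hL π)
  have hGm := M.measurable_condValue 𝒜 hL π T (n + 1)
  let K : (ℕ → X × U) → ℝ≥0∞ := fun ω =>
    ∫⁻ x, M.condValue 𝒜 L π T (n + 1) (pathGlue n ω (x, (ω n).2)) ∂M.kernel (ω n)
  have hK : Measurable K := by
    have h : Measurable fun p : (ℕ → X × U) × X =>
      M.condValue 𝒜 L π T (n + 1) (pathGlue n p.1 (p.2, (p.1 n).2)) := hGm.comp (by fun_prop)
    exact h.lintegral_kernel_prod_right' (κ := M.kernel.comap _ (measurable_pi_apply n))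
  have e1 : ∫⁻ ω, M.condValue 𝒜 L π T (n + 1) ω ∂P = ∫⁻ ω, K ω ∂P := by
    have h : ∀ ω, M.condValue 𝒜 L π T (n + 1) ω =
        M.condValue 𝒜 L π T (n + 1) (pathGlue n ω (ω (n + 1))) := fun ω =>
      M.condValue_congr 𝒜 L π T _ fun k hk => by
        rcases Nat.le_succ_iff.1 hk with h | rfl
        · rw [pathGlue_of_le h]
        · rw [pathGlue_of_lt n.lt_succ_self]
    rw [lintegral_congr h, M.lintegral_closedLoop_succ _ n hGm]
    refine lintegral_congr fun ω => lintegral_congr fun x => ?_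
    have h : ∀ u, M.condValue 𝒜 L π T (n + 1) (pathGlue n ω (x, u)) =
        M.condValue 𝒜 L π T (n + 1) (pathGlue n ω (x, (ω n).2)) := fun u =>
      M.condValue_congr 𝒜 L π T _ fun k hk => by
        by_cases h : k ≤ n
        · rw [pathGlue_of_le h, pathGlue_of_le h]
        · rw [pathGlue_of_lt (not_le.1 h), pathGlue_of_lt (not_le.1 h)]
    simp [h]
  have e3 : ∀ ω, K ω = K (setAction n ω (ω n).2) := fun ω => by
    have h : ∀ x, pathGlue n (setAction n ω (ω n).2) x = pathGlue n ω x := fun x => by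
      funext k
      by_cases hk : k ≤ n <;> simp [pathGlue, hk, setAction_self]
    have h' : setAction n ω (ω n).2 n = ω n := by
      rw [setAction_self, pathGlue_of_le le_rfl]
    simp only [K, h, h']
  rw [e1, lintegral_congr e3, M.lintegral_closedLoop_setAction _ n hK]
  refine lintegral_congr fun ω => ?_
  have hKs : Measurable fun u => K (setAction n ω u) := hK.comp (by fun_prop)
  rw [act_policyStrategy, lintegral_dirac' _ hKs]
  set u := π.act n ((ω n).1, 𝒜.run (M.word L ω) (n + 1)) with hu
  have h1 : ∀ k ≤ n, (setAction n ω u k).1 = (ω k).1 := fun k hk => by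
    rcases hk.lt_or_eq with h | rfl
    · simp [setAction, h]
    · simp [setAction]
  have h2 : setAction n ω u n = ((ω n).1, u) := by simp [setAction]
  have hrun : ∀ x, ∀ t ≤ n, 𝒜.run (M.word L (pathGlue n (setAction n ω u) (x, u))) (t + 1) =
      𝒜.run (M.word L ω) (t + 1) := fun x t ht => 𝒜.run_congr fun k hk => by
    simp only [word, pathGlue_of_le (show k ≤ n by omega), h1 k (by omega)]
  have hG : ∀ x, M.condValue 𝒜 L π T (n + 1) (pathGlue n (setAction n ω u) (x, u)) =
      if ∃ t < n + 1, 𝒜.run (M.word L ω) (t + 1) ∈ 𝒜.accept then 1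
      else M.value 𝒜 L π T (T - (n + 1))
        (𝒜.step (𝒜.run (M.word L ω) (n + 1)) (L (M.out x))) x := by
    intro x
    have hex : (∃ t < n + 1, 𝒜.run (M.word L (pathGlue n (setAction n ω u) (x, u))) (t + 1) ∈
        𝒜.accept) ↔ ∃ t < n + 1, 𝒜.run (M.word L ω) (t + 1) ∈ 𝒜.accept :=
      exists_congr fun t => and_congr_right fun ht => by rw [hrun x t (by omega)]
    have hrun' : 𝒜.run (M.word L (pathGlue n (setAction n ω u) (x, u))) (n + 1 + 1) =
        𝒜.step (𝒜.run (M.word L ω) (n + 1)) (L (M.out x)) := by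
      rw [DFA.run, hrun x n le_rfl]
      simp [word, pathGlue]
    unfold condValue
    rw [hrun', pathGlue_of_lt n.lt_succ_self]
    by_cases hc : ∃ t < n + 1, 𝒜.run (M.word L ω) (t + 1) ∈ 𝒜.accept
    · rw [if_pos hc, if_pos (hex.2 hc)]
    · rw [if_neg hc, if_neg (mt hex.1 hc)]
  simp only [K, h2, hG]
  -- Acceptance before `n` makes both sides `1`; acceptance exactly at `n` does too, since the value
  -- of an accepting state is `1`; otherwise the claim is the value recursion.
  by_cases hlt : ∃ t < n, 𝒜.run (M.word L ω) (t + 1) ∈ 𝒜.accept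
  · have hlt' : ∃ t < n + 1, 𝒜.run (M.word L ω) (t + 1) ∈ 𝒜.accept := by
      obtain ⟨t, ht, h⟩ := hlt
      exact ⟨t, ht.trans n.lt_succ_self, h⟩
    simp only [if_pos hlt']
    simp [condValue, hlt]
  · by_cases hacc : 𝒜.run (M.word L ω) (n + 1) ∈ 𝒜.accept
    · have hlt' : ∃ t < n + 1, 𝒜.run (M.word L ω) (t + 1) ∈ 𝒜.accept := ⟨n, n.lt_succ_self, hacc⟩
      simp only [if_pos hlt']
      simp [condValue, hlt, M.value_of_mem 𝒜 L π _ _ hacc]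
    · have hlt' : ¬ ∃ t < n + 1, 𝒜.run (M.word L ω) (t + 1) ∈ 𝒜.accept := by
        rintro ⟨t, ht, h⟩
        rcases Nat.lt_succ_iff_lt_or_eq.1 ht with h' | rfl
        exacts [hlt ⟨t, h', h⟩, hacc h]
      -- The recursion counts remaining time and the policy elapsed time: with `T - n` steps left,
      -- the action used is that of time `n`.
      have hT : T - n = T - (n + 1) + 1 := by omega
      have hT' : T - 1 - (T - (n + 1)) = n := by omega
      simp only [condValue, hlt, hlt', if_false]
      rw [hT, M.value_succ_of_notMem 𝒜 L π _ _ hacc, hT']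

/-- The value function at the initial state is the probability of satisfaction. -/
theorem value_init_eq (M : GMDP X U Y) (𝒜 : DFA α Q) {L : Y → α} (hL : Measurable L)
    (π : MarkovPolicy X Q U) (T : ℕ) :
    M.value 𝒜 L π T T (𝒜.step 𝒜.start (L (M.out M.init))) M.init =
      M.closedLoop (M.policyStrategy 𝒜 hL π) {ω | 𝒜.Satisfies T (M.word L ω)} := by
  set P := M.closedLoop (M.policyStrategy 𝒜 hL π) with hP
  have hconst : ∀ n ≤ T, ∫⁻ ω, M.condValue 𝒜 L π T n ω ∂P = ∫⁻ ω, M.condValue 𝒜 L π T 0 ω ∂P := by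
    intro n hn
    induction n with
    | zero => rfl
    | succ n ih => rw [hP, M.lintegral_condValue_succ 𝒜 hL π hn, ih (by omega)]
  have h0 : ∫⁻ ω, M.condValue 𝒜 L π T 0 ω ∂P =
      M.value 𝒜 L π T T (𝒜.step 𝒜.start (L (M.out M.init))) M.init := by
    have hstep : Measurable fun x => 𝒜.step 𝒜.start (L (M.out x)) :=
      (Measurable.of_discrete (f := 𝒜.step 𝒜.start)).comp (hL.comp M.measurable_out)
    have h : Measurable fun z : X × U =>
        M.value 𝒜 L π T T (𝒜.step 𝒜.start (L (M.out z.1))) z.1 :=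
      (M.measurable_value 𝒜 hL π T T).comp ((hstep.comp measurable_fst).prodMk measurable_fst)
    have e : ∀ ω, M.condValue 𝒜 L π T 0 ω =
        M.value 𝒜 L π T T (𝒜.step 𝒜.start (L (M.out (ω 0).1))) (ω 0).1 := fun ω => by
      simp [condValue, DFA.run, word]
    rw [lintegral_congr e, M.lintegral_closedLoop_zero _ h]
    simp
  -- With no time left, the value is the indicator of acceptance at time `T`.
  have hT : ∀ ω, M.condValue 𝒜 L π T T ω =
      {ω | 𝒜.Satisfies T (M.word L ω)}.indicator 1 ω := fun ω => by
    by_cases hlt : ∃ t < T, 𝒜.run (M.word L ω) (t + 1) ∈ 𝒜.accept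
    · have : 𝒜.Satisfies T (M.word L ω) := by
        obtain ⟨t, ht, h⟩ := hlt
        exact ⟨t, ht.le, h⟩
      simp [condValue, hlt, this]
    · have : 𝒜.Satisfies T (M.word L ω) ↔ 𝒜.run (M.word L ω) (T + 1) ∈ 𝒜.accept := by
        refine ⟨fun ⟨t, ht, h⟩ => ?_, fun h => ⟨T, le_rfl, h⟩⟩
        rcases ht.lt_or_eq with h' | rfl
        exacts [(hlt ⟨t, h', h⟩).elim, h]
      by_cases hc : 𝒜.Satisfies T (M.word L ω)
      · have h1 := this.1 hc
        simp [condValue, hlt, value, hc, h1]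
      · have h1 := mt this.2 hc
        simp [condValue, hlt, value, hc, h1]
  rw [← h0, ← hconst T le_rfl, lintegral_congr hT,
    lintegral_indicator_one (𝒜.measurableSet_satisfies (M.measurable_word hL) T)]

end GMDP

/-! ### Couplings and the glued system. -/

namespace GMDP

variable {Xh Uh X U Y : Type*} [MeasurableSpace Xh] [MeasurableSpace Uh] [MeasurableSpace X]
  [MeasurableSpace U] [MeasurableSpace Y]

/-- `W` couples the transition kernels of `Mh` and of `M` with the interface `𝒰`. -/
structure IsCoupling (Mh : GMDP Xh Uh Y) (M : GMDP X U Y) (𝒰 : Kernel (Uh × Xh × X) U)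
    (W : Kernel (Uh × Xh × X) (Xh × X)) : Prop where
  fst : ∀ p, (W p).map Prod.fst = Mh.kernel (p.2.1, p.1)
  snd : ∀ p, (W p).map Prod.snd = (𝒰 p).bind fun u => M.kernel (p.2.2, u)

/-- A simulation relation with a lifting that couples the transition kernels at all pairs of
states, related or not. -/
theorem SimulatedBy.exists_isCoupling {Y : Type*} [MetricSpace Y] [MeasurableSpace Y]
    {Mh : GMDP Xh Uh Y} {M : GMDP X U Y} {δ : ℝ} (h : Mh.SimulatedBy M 0 δ) :
    ∃ (R : Set (Xh × X)) (𝒰 : Kernel (Uh × Xh × X) U) (W : Kernel (Uh × Xh × X) (Xh × X)),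
      MeasurableSet R ∧ IsMarkovKernel 𝒰 ∧ IsMarkovKernel W ∧ (Mh.init, M.init) ∈ R ∧
      (∀ s ∈ R, Mh.out s.1 = M.out s.2) ∧ IsCoupling Mh M 𝒰 W ∧
      ∀ p, p.2 ∈ R → (W p).real Rᶜ ≤ δ := by
  classical
  obtain ⟨R, 𝒰, W, hR, h𝒰, hW, hinit, hdist, hlift⟩ := h
  have hs : MeasurableSet {p : Uh × Xh × X | p.2 ∈ R} := measurable_snd hR
  have hm : Measurable fun q : (Uh × Xh × X) × U => (q.1.2.2, q.2) := by fun_prop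
  have hmh : Measurable fun p : Uh × Xh × X => (p.2.1, p.1) := by fun_prop
  let S : Kernel (Uh × Xh × X) X := Kernel.snd (𝒰 ⊗ₖ M.kernel.comap _ hm)
  have hS : ∀ p, S p = (𝒰 p).bind fun u => M.kernel (p.2.2, u) := fun p => by
    have hmu : Measurable fun u => M.kernel (p.2.2, u) :=
      M.kernel.measurable.comp measurable_prodMk_left
    ext A hA
    rw [Kernel.snd_apply' _ _ hA, Kernel.compProd_apply (measurable_snd hA),
      Measure.bind_apply hA hmu.aemeasurable]
    rfl
  -- Off the relation nothing is known about `W`. Independent moves keep both marginals correct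
  -- there, so the joint process can go on after leaving the relation.
  let W' := Kernel.piecewise hs W (Mh.kernel.comap _ hmh ×ₖ S)
  refine ⟨R, 𝒰, W', hR, h𝒰, inferInstance, hinit,
    fun s hs => dist_le_zero.1 (hdist s.1 s.2 hs), ⟨fun p => ?_, fun p => ?_⟩, fun p hp => ?_⟩
  · by_cases hp : p.2 ∈ R
    · have hWp : W' p = W p := by rw [Kernel.piecewise_apply]; exact if_pos hp
      ext A hA
      rw [hWp, Measure.map_apply measurable_fst hA, ← (hlift p.1 p.2.1 p.2.2 hp).1 A hA,
        Set.prod_univ]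
    · have hWp : W' p = (Mh.kernel.comap _ hmh ×ₖ S) p := by
        rw [Kernel.piecewise_apply]; exact if_neg hp
      rw [hWp, Kernel.prod_apply]
      exact Measure.fst_prod
  · by_cases hp : p.2 ∈ R
    · have hWp : W' p = W p := by rw [Kernel.piecewise_apply]; exact if_pos hp
      ext A hA
      rw [hWp, Measure.map_apply measurable_snd hA, ← (hlift p.1 p.2.1 p.2.2 hp).2.1 A hA,
        Set.univ_prod]
    · have hWp : W' p = (Mh.kernel.comap _ hmh ×ₖ S) p := by
        rw [Kernel.piecewise_apply]; exact if_neg hp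
      rw [hWp, Kernel.prod_apply, ← hS]
      exact Measure.snd_prod
  · have hWp : W' p = W p := by rw [Kernel.piecewise_apply]; exact if_pos hp
    rw [hWp, probReal_compl_eq_one_sub hR]
    linarith [(hlift p.1 p.2.1 p.2.2 hp).2.2]

/-- The joint evolution of the states of two coupled systems, driven by the inputs of the first. -/
noncomputable def coupledSystem (Mh : GMDP Xh Uh Y) (M : GMDP X U Y)
    (W : Kernel (Uh × Xh × X) (Xh × X)) [IsMarkovKernel W] : GMDP (Xh × X) Uh Y where
  init := (Mh.init, M.init)
  kernel := W.comap Prod.swap measurable_swap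
  markov := inferInstance
  out s := Mh.out s.1
  measurable_out := Mh.measurable_out.comp measurable_fst

/-- The joint evolution of the states of two coupled systems, driven by the inputs of both: the
second system moves by its own kernel, and the first one by the conditional kernel of the
coupling. -/
noncomputable def gluedSystem [StandardBorelSpace Xh] [Nonempty Xh] [StandardBorelSpace X]
    (Mh : GMDP Xh Uh Y) (M : GMDP X U Y)
    (W : Kernel (Uh × Xh × X) (Xh × X)) [IsMarkovKernel W] : GMDP (Xh × X) (Uh × U) Y where
  init := (Mh.init, M.init)
  kernel := ((M.kernel.comap (fun p : (Xh × X) × (Uh × U) => (p.1.2, p.2.2)) (by fun_prop)) ⊗ₖ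
    ((W.map Prod.swap).condKernel.comap
      (fun q : ((Xh × X) × (Uh × U)) × X => ((q.1.2.1, q.1.1), q.2)) (by fun_prop))).map Prod.swap
  markov := Kernel.IsMarkovKernel.map _ measurable_swap
  out s := Mh.out s.1
  measurable_out := Mh.measurable_out.comp measurable_fst

theorem lintegral_gluedSystem [StandardBorelSpace Xh] [Nonempty Xh] [StandardBorelSpace X]
    (Mh : GMDP Xh Uh Y) (M : GMDP X U Y) (W : Kernel (Uh × Xh × X) (Xh × X)) [IsMarkovKernel W]
    (p : (Xh × X) × (Uh × U)) {f : Xh × X → ℝ≥0∞} (hf : Measurable f) :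
    ∫⁻ s, f s ∂(Mh.gluedSystem M W).kernel p =
      ∫⁻ x, ∫⁻ xh, f (xh, x) ∂(W.map Prod.swap).condKernel ((p.2.1, p.1), x)
        ∂M.kernel (p.1.2, p.2.2) := by
  have hsw : Measurable fun q : X × Xh => f q.swap := hf.comp measurable_swap
  simp only [gluedSystem]
  rw [Kernel.lintegral_map _ measurable_swap _ hf, Kernel.lintegral_compProd _ _ _ hsw]
  rfl

/-- Averaged over the interface, the concrete successor has the second marginal of `W`. The abstract
successor is drawn from the conditional of `W`, which does not depend on `u`, so disintegration
restores `W`. -/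
theorem IsCoupling.lintegral_lintegral_gluedSystem [StandardBorelSpace Xh] [Nonempty Xh]
    [StandardBorelSpace X] {Mh : GMDP Xh Uh Y} {M : GMDP X U Y} {𝒰 : Kernel (Uh × Xh × X) U}
    {W : Kernel (Uh × Xh × X) (Xh × X)} [IsMarkovKernel W] (h : IsCoupling Mh M 𝒰 W)
    (uh : Uh) (s : Xh × X) {f : Xh × X → ℝ≥0∞} (hf : Measurable f) :
    ∫⁻ u, ∫⁻ s', f s' ∂(Mh.gluedSystem M W).kernel (s, (uh, u)) ∂𝒰 (uh, s) =
      ∫⁻ s', f s' ∂W (uh, s) := by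
  have : IsMarkovKernel (W.map Prod.swap) := Kernel.IsMarkovKernel.map _ measurable_swap
  have hmu : Measurable fun u => M.kernel (s.2, u) :=
    M.kernel.measurable.comp measurable_prodMk_left
  have hg : Measurable fun p : ((Uh × Xh × X) × X) × Xh => f (p.2, p.1.2) := by fun_prop
  have hg' : Measurable fun x =>
      ∫⁻ xh, f (xh, x) ∂(W.map Prod.swap).condKernel ((uh, s), x) :=
    hg.lintegral_kernel_prod_right'.comp measurable_prodMk_left
  have hfst : (W.map Prod.swap).fst (uh, s) = (𝒰 (uh, s)).bind fun u => M.kernel (s.2, u) := by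
    rw [← h.snd, Kernel.fst_apply, Kernel.map_apply _ measurable_swap,
      Measure.map_map measurable_fst measurable_swap]
    rfl
  have hsw : Measurable fun q : X × Xh => f (q.2, q.1) := hf.comp measurable_swap
  have e := Kernel.lintegral_compProd (W.map Prod.swap).fst (W.map Prod.swap).condKernel (uh, s)
    hsw
  rw [Kernel.disintegrate, Kernel.lintegral_map _ measurable_swap _ hsw,
    hfst, Measure.lintegral_bind hmu.aemeasurable hg'.aemeasurable] at e
  simp only [lintegral_gluedSystem _ _ _ _ hf]
  exact e.symm

end GMDP

/-! ### Joint strategies and the marginals of the joint laws. -/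

namespace Strategy

variable {Xh Uh X U : Type*} [MeasurableSpace Xh] [MeasurableSpace Uh] [MeasurableSpace X]
  [MeasurableSpace U]

/-- A strategy for the first of two systems, as a strategy that observes the states of both. -/
noncomputable def lift (C : Strategy Xh Uh) (X : Type*) [MeasurableSpace X] :
    Strategy (Xh × X) Uh where
  init := C.init.comap Prod.fst measurable_fst
  step n := (C.step n).comap
    (fun p : (Finset.Iic n → (Xh × X) × Uh) × (Xh × X) =>
      (fun i => ((p.1 i).1.1, (p.1 i).2), p.2.1)) (by fun_prop)
  markov_init := inferInstance
  markov_step _ := inferInstance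

/-- The strategy that refines the actions of `C` by those of the interface `𝒰`. -/
noncomputable def refine (C : Strategy (Xh × X) Uh) (𝒰 : Kernel (Uh × Xh × X) U)
    [IsMarkovKernel 𝒰] : Strategy (Xh × X) (Uh × U) where
  init := C.init ⊗ₖ 𝒰.comap Prod.swap measurable_swap
  step n := ((C.step n).comap
      (fun p : (Finset.Iic n → (Xh × X) × (Uh × U)) × (Xh × X) =>
        (fun i => ((p.1 i).1, (p.1 i).2.1), p.2)) (by fun_prop)) ⊗ₖ
    𝒰.comap (fun q => (q.2, q.1.2)) (by fun_prop)
  markov_init := inferInstance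
  markov_step _ := inferInstance

theorem lintegral_act_refine (C : Strategy (Xh × X) Uh) (𝒰 : Kernel (Uh × Xh × X) U)
    [IsMarkovKernel 𝒰] (n : ℕ) (ω : ℕ → (Xh × X) × (Uh × U)) {f : Uh × U → ℝ≥0∞}
    (hf : Measurable f) :
    ∫⁻ v, f v ∂(C.refine 𝒰).act n ω =
      ∫⁻ uh, ∫⁻ u, f (uh, u) ∂𝒰 (uh, (ω n).1)
        ∂C.act n (fun k => ((ω k).1, (ω k).2.1)) := by
  cases n with
  | zero =>
    simp only [act, refine, Kernel.comap_apply]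
    rw [Kernel.lintegral_compProd _ _ _ hf]
    rfl
  | succ n =>
    simp only [act, refine, Kernel.comap_apply]
    rw [Kernel.lintegral_compProd _ _ _ hf]
    rfl

end Strategy

namespace GMDP

variable {Xh Uh X U Y : Type*} [MeasurableSpace Xh] [MeasurableSpace Uh] [MeasurableSpace X]
  [MeasurableSpace U] [MeasurableSpace Y]

/-- The first of two coupled systems evolves as if it were alone. -/
theorem IsCoupling.map_closedLoop_coupledSystem {Mh : GMDP Xh Uh Y} {M : GMDP X U Y}
    {𝒰 : Kernel (Uh × Xh × X) U} {W : Kernel (Uh × Xh × X) (Xh × X)} [IsMarkovKernel W]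
    (h : IsCoupling Mh M 𝒰 W) (C : Strategy Xh Uh) :
    ((Mh.coupledSystem M W).closedLoop (C.lift X)).map (fun ω k => ((ω k).1.1, (ω k).2)) =
      Mh.closedLoop C := by
  have hpr : Measurable fun (ω : ℕ → (Xh × X) × Uh) k => ((ω k).1.1, (ω k).2) := by fun_prop
  have := Measure.isProbabilityMeasure_map (μ := (Mh.coupledSystem M W).closedLoop (C.lift X))
    hpr.aemeasurable
  refine eq_closedLoop _ _ (fun f hf => ?_) fun n f hf => ?_
  · rw [lintegral_map (by fun_prop) hpr]
    exact lintegral_closedLoop_zero _ _ (f := fun z : (Xh × X) × Uh => f (z.1.1, z.2))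
      (by fun_prop)
  · have hF : Measurable fun p : (Finset.Iic n → (Xh × X) × Uh) × ((Xh × X) × Uh) =>
      f (fun i => ((p.1 i).1.1, (p.1 i).2), (p.2.1.1, p.2.2)) := by fun_prop
    have hg : Measurable fun q : (Finset.Iic n → Xh × Uh) × Xh =>
        ∫⁻ uh, f (q.1, (q.2, uh)) ∂C.step n q := by
      have h : Measurable fun q : ((Finset.Iic n → Xh × Uh) × Xh) × Uh =>
        f (q.1.1, (q.1.2, q.2)) := by fun_prop
      exact h.lintegral_kernel_prod_right'
    have hG : Measurable fun ω : ℕ → Xh × Uh =>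
        ∫⁻ x, ∫⁻ uh, f (pathHist n ω, (x, uh)) ∂C.step n (pathHist n ω, x) ∂Mh.kernel (ω n) := by
      have h : Measurable fun p : (ℕ → Xh × Uh) × Xh =>
          ∫⁻ uh, f (pathHist n p.1, (p.2, uh)) ∂C.step n (pathHist n p.1, p.2) :=
        hg.comp (f := fun p : (ℕ → Xh × Uh) × Xh => (pathHist n p.1, p.2)) (by fun_prop)
      exact h.lintegral_kernel_prod_right' (κ := Mh.kernel.comap _ (measurable_pi_apply n))
    rw [lintegral_map (by fun_prop) hpr, lintegral_map hG hpr]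
    refine (lintegral_closedLoop_hist _ _ n hF).trans (lintegral_congr fun ω => ?_)
    have hgω : Measurable fun x => ∫⁻ uh, f (pathHist n fun k => ((ω k).1.1, (ω k).2), (x, uh))
        ∂C.step n (pathHist n fun k => ((ω k).1.1, (ω k).2), x) := hg.comp measurable_prodMk_left
    -- The lifted strategy ignores the concrete state, so only the first marginal of `W` matters.
    rw [← h.fst ((ω n).2, (ω n).1), lintegral_map hgω measurable_fst]
    rfl

/-- Forgetting the inputs of the second system in the glued system gives the coupled system. -/
theorem IsCoupling.map_closedLoop_gluedSystem [StandardBorelSpace Xh] [Nonempty Xh]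
    [StandardBorelSpace X] {Mh : GMDP Xh Uh Y} {M : GMDP X U Y} {𝒰 : Kernel (Uh × Xh × X) U}
    [IsMarkovKernel 𝒰] {W : Kernel (Uh × Xh × X) (Xh × X)} [IsMarkovKernel W]
    (h : IsCoupling Mh M 𝒰 W) (C : Strategy (Xh × X) Uh) :
    ((Mh.gluedSystem M W).closedLoop (C.refine 𝒰)).map (fun ω k => ((ω k).1, (ω k).2.1)) =
      (Mh.coupledSystem M W).closedLoop C := by
  have hpr : Measurable fun (ω : ℕ → (Xh × X) × (Uh × U)) k => ((ω k).1, (ω k).2.1) := by fun_prop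
  have := Measure.isProbabilityMeasure_map
    (μ := (Mh.gluedSystem M W).closedLoop (C.refine 𝒰)) hpr.aemeasurable
  refine eq_closedLoop _ _ (fun f hf => ?_) fun n f hf => ?_
  · rw [lintegral_map (by fun_prop) hpr]
    refine (lintegral_closedLoop_zero _ _
      (f := fun z : (Xh × X) × (Uh × U) => f (z.1, z.2.1)) (by fun_prop)).trans ?_
    simp only [Strategy.refine]
    rw [Kernel.lintegral_compProd _ _ _ (by fun_prop)]
    simp
    rfl
  · let g : (Finset.Iic n → (Xh × X) × Uh) × (Xh × X) → ℝ≥0∞ := fun q =>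
      ∫⁻ uh, f (q.1, (q.2, uh)) ∂C.step n q
    have hg : Measurable g := by
      have h : Measurable fun q : ((Finset.Iic n → (Xh × X) × Uh) × (Xh × X)) × Uh =>
        f (q.1.1, (q.1.2, q.2)) := by fun_prop
      exact h.lintegral_kernel_prod_right'
    let G : (ℕ → (Xh × X) × Uh) → ℝ≥0∞ := fun ω =>
      ∫⁻ s, g (pathHist n ω, s) ∂(Mh.coupledSystem M W).kernel (ω n)
    have hgp : Measurable fun p : (ℕ → (Xh × X) × Uh) × (Xh × X) => g (pathHist n p.1, p.2) := by
      fun_prop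
    have hG : Measurable G :=
      hgp.lintegral_kernel_prod_right'
        (κ := (Mh.coupledSystem M W).kernel.comap _ (measurable_pi_apply n))
    let F : (ℕ → (Xh × X) × (Uh × U)) → ℝ≥0∞ := fun ω =>
      ∫⁻ s, g (pathHist n fun k => ((ω k).1, (ω k).2.1), s) ∂(Mh.gluedSystem M W).kernel (ω n)
    have hF : Measurable F := by
      have h : Measurable fun p : (ℕ → (Xh × X) × (Uh × U)) × (Xh × X) =>
        g (pathHist n fun k => ((p.1 k).1, (p.1 k).2.1), p.2) := by fun_prop
      exact h.lintegral_kernel_prod_right'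
        (κ := (Mh.gluedSystem M W).kernel.comap _ (measurable_pi_apply n))
    have hFf : Measurable fun p : (Finset.Iic n → (Xh × X) × (Uh × U)) ×
        ((Xh × X) × (Uh × U)) =>
      f (fun i => ((p.1 i).1, (p.1 i).2.1), (p.2.1, p.2.2.1)) := by fun_prop
    rw [lintegral_map (by fun_prop) hpr, lintegral_map hG hpr]
    have e1 := lintegral_closedLoop_hist (Mh.gluedSystem M W) (C.refine 𝒰) n hFf
    have e2 : ∀ ω : ℕ → (Xh × X) × (Uh × U), ∫⁻ s, ∫⁻ v,
        f (fun i => ((pathHist n ω i).1, (pathHist n ω i).2.1), (s, v.1))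
          ∂(C.refine 𝒰).step n (pathHist n ω, s) ∂(Mh.gluedSystem M W).kernel (ω n) = F ω := by
      intro ω
      refine lintegral_congr fun s => ?_
      simp only [Strategy.refine]
      rw [Kernel.lintegral_compProd _ _ _ (by fun_prop)]
      simp
      rfl
    refine (e1.trans (lintegral_congr e2)).trans ?_
    have hloc : ∀ ω : ℕ → (Xh × X) × (Uh × U), ∀ k ≤ n, setAction n ω (ω n).2 k = ω k := by
      intro ω k hk
      rw [setAction_self, pathGlue_of_le hk]
    have eF : ∀ ω, F ω = F (setAction n ω (ω n).2) := by
      intro ω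
      have h : (pathHist n fun k => ((setAction n ω (ω n).2 k).1, (setAction n ω (ω n).2 k).2.1)) =
          pathHist n fun k => ((ω k).1, (ω k).2.1) :=
        funext fun k => by simp only [pathHist, hloc ω k (Finset.mem_Iic.1 k.2)]
      simp only [F, h, hloc ω n le_rfl]
    let G' : (ℕ → (Xh × X) × (Uh × U)) → ℝ≥0∞ := fun ω => G fun k => ((ω k).1, (ω k).2.1)
    have hG' : Measurable G' := hG.comp hpr
    have eG : ∀ ω, G' ω = G' (setAction n ω (ω n).2) := by
      intro ω
      have h : (pathHist n fun k => ((setAction n ω (ω n).2 k).1, (setAction n ω (ω n).2 k).2.1)) =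
          pathHist n fun k => ((ω k).1, (ω k).2.1) :=
        funext fun k => by simp only [pathHist, hloc ω k (Finset.mem_Iic.1 k.2)]
      simp only [G', G, h, hloc ω n le_rfl]
    change _ = ∫⁻ ω, G' ω ∂_
    -- For a fixed `u` the glued transition is not `W`. Both sides are therefore conditioned on the
    -- action at time `n`, so that the average over the interface can be taken.
    rw [lintegral_congr eF, lintegral_congr eG, lintegral_closedLoop_setAction _ _ n hF,
      lintegral_closedLoop_setAction _ _ n hG']
    refine lintegral_congr fun ω => ?_
    have hFω : Measurable fun v => F (setAction n ω v) := hF.comp (by fun_prop)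
    have hGω : Measurable fun v => G' (setAction n ω v) := hG'.comp (by fun_prop)
    rw [Strategy.lintegral_act_refine _ _ _ _ hFω, Strategy.lintegral_act_refine _ _ _ _ hGω]
    refine lintegral_congr fun uh => ?_
    have hset : ∀ u : U, (fun k => ((setAction n ω (uh, u) k).1, (setAction n ω (uh, u) k).2.1)) =
        setAction n (fun k => ((ω k).1, (ω k).2.1)) uh := by
      intro u
      funext k
      by_cases hk : k < n <;> simp [setAction, hk]
    have hn : ∀ u : U, setAction n ω (uh, u) n = ((ω n).1, (uh, u)) := fun u => by simp [setAction]
    have hn' : setAction n (fun k => ((ω k).1, (ω k).2.1)) uh n = ((ω n).1, uh) := by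
      simp [setAction]
    simp only [F, G', hset, hn, lintegral_const, measure_univ, mul_one]
    have hgω : Measurable fun s =>
      g (pathHist n (setAction n (fun k => ((ω k).1, (ω k).2.1)) uh), s) := by fun_prop
    rw [h.lintegral_lintegral_gluedSystem uh (ω n).1 hgω]
    simp only [G, hn']
    rfl

/-- The second system of the glued system evolves by its own kernel, under some strategy. -/
theorem exists_map_closedLoop_gluedSystem [StandardBorelSpace Xh] [Nonempty Xh]
    [StandardBorelSpace X] [StandardBorelSpace U] (Mh : GMDP Xh Uh Y) (M : GMDP X U Y)
    (W : Kernel (Uh × Xh × X) (Xh × X)) [IsMarkovKernel W] (C : Strategy (Xh × X) (Uh × U)) :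
    ∃ C' : Strategy X U,
      ((Mh.gluedSystem M W).closedLoop C).map (fun ω k => ((ω k).1.2, (ω k).2.2)) =
        M.closedLoop C' := by
  have hpr : Measurable fun (ω : ℕ → (Xh × X) × (Uh × U)) k => ((ω k).1.2, (ω k).2.2) := by
    fun_prop
  have := Measure.isProbabilityMeasure_map
    (μ := (Mh.gluedSystem M W).closedLoop C) hpr.aemeasurable
  refine exists_eq_closedLoop _ ?_ fun n f hf => ?_
  · refine Measure.ext_of_lintegral _ fun f hf => ?_
    rw [lintegral_map hf (by fun_prop), lintegral_map (by fun_prop) hpr, lintegral_dirac' _ hf]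
    refine (lintegral_closedLoop_zero _ _
      (f := fun z : (Xh × X) × (Uh × U) => f z.1.2) (by fun_prop)).trans ?_
    simp
    rfl
  · have hFf : Measurable fun p : (Finset.Iic n → (Xh × X) × (Uh × U)) ×
        ((Xh × X) × (Uh × U)) =>
      f (fun i => ((p.1 i).1.2, (p.1 i).2.2), p.2.1.2) := by fun_prop
    have hG : Measurable fun ω : ℕ → X × U => ∫⁻ x, f (pathHist n ω, x) ∂M.kernel (ω n) := by
      have h : Measurable fun p : (ℕ → X × U) × X => f (pathHist n p.1, p.2) := by fun_prop
      exact h.lintegral_kernel_prod_right' (κ := M.kernel.comap _ (measurable_pi_apply n))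
    rw [lintegral_map (by fun_prop) hpr, lintegral_map hG hpr]
    refine (lintegral_closedLoop_hist _ _ n hFf).trans (lintegral_congr fun ω => ?_)
    simp only [lintegral_const, measure_univ, mul_one]
    -- The integrand does not see the abstract successor, so its conditional kernel integrates to
    -- `1` and the concrete kernel remains.
    rw [lintegral_gluedSystem _ _ _ _ (by fun_prop)]
    simp
    rfl

end GMDP

/-! ### Escape from the relation and the loss of probability. -/

namespace GMDP

section Escape

variable {X U Y : Type*} [MeasurableSpace X] [MeasurableSpace U] [MeasurableSpace Y]

/-- The probability that an event of the past is followed by a transition into `D`. -/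
theorem closedLoop_inter_le (M : GMDP X U Y) (C : Strategy X U) (n : ℕ) {S : Set (ℕ → X × U)}
    (hS : MeasurableSet S) (hdep : ∀ ω z, pathGlue n ω z ∈ S ↔ ω ∈ S) {D : Set X}
    (hD : MeasurableSet D) {r : ℝ≥0∞} (hr : ∀ ω ∈ S, M.kernel (ω n) D ≤ r) :
    M.closedLoop C {ω | ω ∈ S ∧ (ω (n + 1)).1 ∈ D} ≤ r * M.closedLoop C S := by
  classical
  have hm : MeasurableSet {ω : ℕ → X × U | ω ∈ S ∧ (ω (n + 1)).1 ∈ D} :=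
    hS.inter ((measurable_fst.comp (measurable_pi_apply (n + 1))) hD)
  -- As `S` depends on the path up to `n` only, the indicator splits into a factor of the past and a
  -- factor of the new state.
  have e : ∀ ω (z : X × U),
      {ω : ℕ → X × U | ω ∈ S ∧ (ω (n + 1)).1 ∈ D}.indicator (1 : (ℕ → X × U) → ℝ≥0∞)
        (pathGlue n ω z) =
        S.indicator (fun _ => D.indicator 1 z.1) ω := fun ω z => by
    simp only [Set.indicator, Set.mem_ofPred_eq, hdep, pathGlue_of_lt n.lt_succ_self,
      Pi.one_apply]
    by_cases h1 : ω ∈ S <;> simp [h1]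
  have e' : ∀ ω,
      {ω : ℕ → X × U | ω ∈ S ∧ (ω (n + 1)).1 ∈ D}.indicator (1 : (ℕ → X × U) → ℝ≥0∞) ω =
      {ω : ℕ → X × U | ω ∈ S ∧ (ω (n + 1)).1 ∈ D}.indicator (1 : (ℕ → X × U) → ℝ≥0∞)
        (pathGlue n ω (ω (n + 1))) := fun ω => by
    rw [e]
    by_cases h1 : ω ∈ S <;> simp [Set.indicator, h1]
  rw [← lintegral_indicator_one hm, lintegral_congr e',
    M.lintegral_closedLoop_succ C n (measurable_one.indicator hm), ← lintegral_indicator_one hS,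
    ← lintegral_const_mul _ (measurable_one.indicator hS)]
  refine lintegral_mono fun ω => ?_
  simp only [e, lintegral_const, measure_univ, mul_one]
  by_cases h1 : ω ∈ S
  · simp only [Set.indicator_of_mem h1, Pi.one_apply, mul_one]
    rw [lintegral_indicator_one hD]
    exact hr ω h1
  · simp [h1]

end Escape

variable {Xh Uh X U Y α Q : Type*} [MeasurableSpace Xh] [MeasurableSpace Uh] [MeasurableSpace X]
  [MeasurableSpace U] [MeasurableSpace Y]

/-- If the first system satisfies the specification and the second one does not, then the states
leave the relation at some time, before which the first system has not satisfied the
specification. -/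
theorem exists_escape {Mh : GMDP Xh Uh Y} {M : GMDP X U Y} {R : Set (Xh × X)}
    (hR : ∀ s ∈ R, Mh.out s.1 = M.out s.2) (𝒜 : DFA α Q) (L : Y → α) (T : ℕ)
    {ω : ℕ → Xh × Uh} {ω' : ℕ → X × U} (h0 : ((ω 0).1, (ω' 0).1) ∈ R)
    (hsat : 𝒜.Satisfies T (Mh.word L ω)) (hnot : ¬ 𝒜.Satisfies T (M.word L ω')) :
    ∃ h ∈ Finset.Icc 1 T, (h : ℕ∞) ≤ 𝒜.hittingTime (Mh.word L ω) ∧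
      ((ω (h - 1)).1, (ω' (h - 1)).1) ∈ R ∧ ((ω h).1, (ω' h).1) ∉ R := by
  classical
  -- While the pair stays related the two words agree, so an abstract acceptance before `h` would be
  -- a concrete one within the horizon.
  have key : ∀ h ≤ T + 1, (∀ k < h, ((ω k).1, (ω' k).1) ∈ R) →
      ∀ t < h, 𝒜.run (Mh.word L ω) (t + 1) ∉ 𝒜.accept := by
    intro h hT hk t ht hmem
    refine hnot ⟨t, by omega, ?_⟩
    rwa [← 𝒜.run_congr (l := Mh.word L ω)]
    intro k hkt
    simp only [word]
    rw [hR _ (hk k (by omega))]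
  have hex : ∃ h, h ≤ T ∧ ((ω h).1, (ω' h).1) ∉ R := by
    by_contra hcon
    push Not at hcon
    obtain ⟨t, ht, hmem⟩ := hsat
    exact key (T + 1) le_rfl (fun k hk => hcon k (by omega)) t (by omega) hmem
  obtain ⟨hT, hesc⟩ := Nat.find_spec hex
  have hmin : ∀ k < Nat.find hex, ((ω k).1, (ω' k).1) ∈ R := fun k hk => by
    by_contra hcon
    exact Nat.find_min hex hk ⟨by omega, hcon⟩
  have hpos : Nat.find hex ≠ 0 := fun h => by
    rw [h] at hesc
    exact hesc h0
  exact ⟨Nat.find hex, Finset.mem_Icc.2 ⟨by omega, hT⟩,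
    𝒜.le_hittingTime_iff.2 (key _ (by omega) hmin), hmin _ (by omega), hesc⟩

variable [MeasurableSpace α] [Finite α] [DiscreteMeasurableSpace α] [Finite Q]
  [MeasurableSpace Q] [DiscreteMeasurableSpace Q]

/-- The probability that the states leave the relation at time `n + 1`, the specification being
not satisfied before. -/
theorem closedLoop_escape_le {Mh : GMDP Xh Uh Y} {M : GMDP X U Y} {𝒰 : Kernel (Uh × Xh × X) U}
    {W : Kernel (Uh × Xh × X) (Xh × X)} [IsMarkovKernel W] (hc : IsCoupling Mh M 𝒰 W)
    {R : Set (Xh × X)} (hRm : MeasurableSet R) {δ : ℝ}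
    (hδ : ∀ p, p.2 ∈ R → (W p).real Rᶜ ≤ δ) (hδ0 : 0 ≤ δ) (C : Strategy Xh Uh) (𝒜 : DFA α Q)
    {L : Y → α} (hL : Measurable L) (n : ℕ) :
    ((Mh.coupledSystem M W).closedLoop (C.lift X)).real
        {ω | ((n + 1 : ℕ) : ℕ∞) ≤ 𝒜.hittingTime (Mh.word L fun k => ((ω k).1.1, (ω k).2)) ∧
          (ω n).1 ∈ R ∧ (ω (n + 1)).1 ∉ R} ≤
      δ * (Mh.closedLoop C).real
        {ω | ((n + 1 : ℕ) : ℕ∞) ≤ 𝒜.hittingTime (Mh.word L ω)} := by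
  set P := (Mh.coupledSystem M W).closedLoop (C.lift X)
  have hpr : Measurable fun (ω : ℕ → (Xh × X) × Uh) k => ((ω k).1.1, (ω k).2) := by fun_prop
  let H : Set (ℕ → Xh × Uh) := {ω | ((n + 1 : ℕ) : ℕ∞) ≤ 𝒜.hittingTime (Mh.word L ω)}
  have hH : MeasurableSet H := 𝒜.measurableSet_le_hittingTime (Mh.measurable_word hL) _
  let H' : Set (ℕ → (Xh × X) × Uh) := (fun ω k => ((ω k).1.1, (ω k).2)) ⁻¹' H
  let S : Set (ℕ → (Xh × X) × Uh) := {ω | ω ∈ H' ∧ (ω n).1 ∈ R}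
  have hS : MeasurableSet S :=
    (hpr hH).inter ((measurable_fst.comp (measurable_pi_apply n)) hRm)
  -- A hitting time of at least `n + 1` is decided by the letters at times `0, …, n`.
  have hdep : ∀ (ω : ℕ → (Xh × X) × Uh) z, pathGlue n ω z ∈ S ↔ ω ∈ S := by
    intro ω z
    have h1 : pathGlue n ω z ∈ H' ↔ ω ∈ H' := by
      simp only [H', H, Set.mem_preimage, Set.mem_ofPred_eq, DFA.le_hittingTime_iff]
      refine forall_congr' fun t => forall_congr' fun ht => not_congr ?_
      rw [𝒜.run_congr fun k hk => ?_]
      simp only [word, pathGlue_of_le (show k ≤ n by omega)]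
    simp only [S, Set.mem_ofPred_eq, h1, pathGlue_of_le le_rfl]
  have hle := (Mh.coupledSystem M W).closedLoop_inter_le (C.lift X) n hS hdep hRm.compl
    (r := ENNReal.ofReal δ) fun ω hω =>
      (ENNReal.le_ofReal_iff_toReal_le (measure_ne_top _ _) hδ0).2 (hδ ((ω n).2, (ω n).1) hω.2)
  have hSH : P S ≤ Mh.closedLoop C H := by
    rw [← hc.map_closedLoop_coupledSystem C, Measure.map_apply hpr hH]
    exact measure_mono fun ω hω => hω.1
  have hset : {ω : ℕ → (Xh × X) × Uh | ω ∈ H' ∧ (ω n).1 ∈ R ∧ (ω (n + 1)).1 ∉ R} =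
      {ω | ω ∈ S ∧ (ω (n + 1)).1 ∈ Rᶜ} := by
    ext ω
    simp only [S, Set.mem_ofPred_eq, and_assoc, Set.mem_compl_iff]
  change P.real {ω : ℕ → (Xh × X) × Uh | ω ∈ H' ∧ (ω n).1 ∈ R ∧ (ω (n + 1)).1 ∉ R} ≤
    δ * (Mh.closedLoop C).real H
  rw [hset, Measure.real, Measure.real, ← ENNReal.toReal_ofReal hδ0, ← ENNReal.toReal_mul]
  exact ENNReal.toReal_mono (ENNReal.mul_ne_top ENNReal.ofReal_ne_top (measure_ne_top _ _))
    (hle.trans (mul_le_mul_right hSH _))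

/-- Any strategy for a simulated system can be refined to a strategy for the simulating one, with a
loss in the probability of satisfaction that is controlled by the hitting time. -/
theorem SimulatedBy.exists_strategy {Y : Type*} [MetricSpace Y] [MeasurableSpace Y]
    [StandardBorelSpace Xh] [StandardBorelSpace X] [StandardBorelSpace U]
    {Mh : GMDP Xh Uh Y} {M : GMDP X U Y} {δ : ℝ} (hsim : Mh.SimulatedBy M 0 δ)
    (Ch : Strategy Xh Uh) (𝒜 : DFA α Q) {L : Y → α} (hL : Measurable L) :
    ∃ C : Strategy X U, ∀ T : ℕ,
      Mh.satProb 𝒜 L Ch T - δ * ∑ h ∈ Finset.Icc 1 T,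
          (Mh.closedLoop Ch).real {ω | (h : ℕ∞) ≤ 𝒜.hittingTime (Mh.word L ω)} ≤
        M.satProb 𝒜 L C T := by
  obtain ⟨R, 𝒰, W, hRm, _, _, hinit, hout, hc, hδ⟩ := hsim.exists_isCoupling
  have : Nonempty Xh := ⟨Mh.init⟩
  -- The initial pair is related, so `δ` bounds a probability as soon as some input exists; an
  -- execution provides one.
  have hδ0 : 0 ≤ δ := by
    obtain ⟨ω⟩ := nonempty_of_isProbabilityMeasure (Mh.closedLoop Ch)
    exact measureReal_nonneg.trans (hδ ((ω 0).2, Mh.init, M.init) hinit)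
  set P := (Mh.gluedSystem M W).closedLoop ((Ch.lift X).refine 𝒰) with hP
  -- The strategy is obtained before `T` is introduced and so serves all horizons.
  obtain ⟨C, hC⟩ := Mh.exists_map_closedLoop_gluedSystem M W ((Ch.lift X).refine 𝒰)
  refine ⟨C, fun T => ?_⟩
  have hpr : Measurable fun (ω : ℕ → (Xh × X) × (Uh × U)) k => ((ω k).1, (ω k).2.1) := by fun_prop
  have hpr1 : Measurable fun (ω : ℕ → (Xh × X) × Uh) k => ((ω k).1.1, (ω k).2) := by fun_prop
  have hpr2 : Measurable fun (ω : ℕ → (Xh × X) × (Uh × U)) k => ((ω k).1.2, (ω k).2.2) := by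
    fun_prop
  have hH1 : MeasurableSet {ω : ℕ → Xh × Uh | 𝒜.Satisfies T (Mh.word L ω)} :=
    𝒜.measurableSet_satisfies (Mh.measurable_word hL) T
  have hH2 : MeasurableSet {ω : ℕ → X × U | 𝒜.Satisfies T (M.word L ω)} :=
    𝒜.measurableSet_satisfies (M.measurable_word hL) T
  let A : Set (ℕ → (Xh × X) × (Uh × U)) :=
    {ω | 𝒜.Satisfies T (Mh.word L fun k => ((ω k).1.1, (ω k).2.1))}
  let B : Set (ℕ → (Xh × X) × (Uh × U)) :=
    {ω | 𝒜.Satisfies T (M.word L fun k => ((ω k).1.2, (ω k).2.2))}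
  -- The initial pair is related only almost surely on path space; this is the null exception.
  let N : Set (ℕ → (Xh × X) × (Uh × U)) := {ω | (ω 0).1 ∉ R}
  let E : ℕ → Set (ℕ → (Xh × X) × Uh) := fun h =>
    {ω | (h : ℕ∞) ≤ 𝒜.hittingTime (Mh.word L fun k => ((ω k).1.1, (ω k).2)) ∧
      (ω (h - 1)).1 ∈ R ∧ (ω h).1 ∉ R}
  have hEm : ∀ h, MeasurableSet (E h) := fun h =>
    (hpr1 (𝒜.measurableSet_le_hittingTime (Mh.measurable_word hL) h)).inter
      (((measurable_fst.comp (measurable_pi_apply (h - 1))) hRm).inter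
        ((measurable_fst.comp (measurable_pi_apply h)) hRm).compl)
  let D : ℕ → Set (ℕ → (Xh × X) × (Uh × U)) := fun h =>
    (fun ω k => ((ω k).1, (ω k).2.1)) ⁻¹' E h
  have hsub : A ⊆ (N ∪ B) ∪ ⋃ h ∈ Finset.Icc 1 T, D h := by
    intro ω hA
    by_cases hN : (ω 0).1 ∈ R
    · by_cases hB : ω ∈ B
      · exact Or.inl (Or.inr hB)
      · obtain ⟨h, hh, hE⟩ := exists_escape hout 𝒜 L T hN hA hB
        exact Or.inr (Set.mem_biUnion (x := h) hh hE)
    · exact Or.inl (Or.inl hN)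
  have hA : P.real A = Mh.satProb 𝒜 L Ch T := by
    rw [satProb, ← hc.map_closedLoop_coupledSystem Ch, ← hc.map_closedLoop_gluedSystem,
      Measure.map_map hpr1 hpr, map_measureReal_apply (hpr1.comp hpr) hH1]
    rfl
  have hB : P.real B = M.satProb 𝒜 L C T := by
    rw [satProb, ← hC, map_measureReal_apply hpr2 hH2]
    rfl
  have hN : P.real N = 0 := by
    have hm : Measurable fun z : (Xh × X) × (Uh × U) => Rᶜ.indicator (1 : Xh × X → ℝ≥0∞) z.1 :=
      (measurable_one.indicator hRm.compl).comp measurable_fst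
    have hNm : MeasurableSet N := ((measurable_fst.comp (measurable_pi_apply 0)) hRm).compl
    have e : P N = ∫⁻ ω, Rᶜ.indicator (1 : Xh × X → ℝ≥0∞) (ω 0).1 ∂P := by
      rw [← lintegral_indicator_one hNm]
      rfl
    have h0 : (Mh.gluedSystem M W).init ∉ Rᶜ := fun h => h hinit
    rw [Measure.real, e, hP, lintegral_closedLoop_zero _ _ hm]
    simp [h0]
  have hD : ∀ h ∈ Finset.Icc 1 T, P.real (D h) ≤
      δ * (Mh.closedLoop Ch).real {ω | (h : ℕ∞) ≤ 𝒜.hittingTime (Mh.word L ω)} := by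
    intro h hh
    obtain ⟨n, rfl⟩ : ∃ n, h = n + 1 := ⟨h - 1, by have := (Finset.mem_Icc.1 hh).1; omega⟩
    -- The escape event does not involve the concrete inputs, so it can be measured in the coupled
    -- system.
    have e : P.real (D (n + 1)) =
        ((Mh.coupledSystem M W).closedLoop (Ch.lift X)).real (E (n + 1)) := by
      rw [← hc.map_closedLoop_gluedSystem, map_measureReal_apply hpr (hEm _)]
    rw [e]
    exact closedLoop_escape_le hc hRm hδ hδ0 Ch 𝒜 hL n
  have hfin : P.real A ≤ P.real N + P.real B + ∑ h ∈ Finset.Icc 1 T, P.real (D h) :=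
    (measureReal_mono hsub).trans ((measureReal_union_le _ _).trans
      (add_le_add (measureReal_union_le _ _) (measureReal_biUnion_finset_le _ _)))
  rw [Finset.mul_sum, ← hA, ← hB]
  linarith [Finset.sum_le_sum hD]

/-- A strategy can be replaced by a deterministic one, for a given horizon. -/
theorem exists_isDeterministic_satProb_le [StandardBorelSpace U] (M : GMDP X U Y) (𝒜 : DFA α Q)
    {L : Y → α} (hL : Measurable L) (C : Strategy X U) (T : ℕ) :
    ∃ C' : Strategy X U, C'.IsDeterministic ∧ M.satProb 𝒜 L C T ≤ M.satProb 𝒜 L C' T := by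
  have hm : MeasurableSet {ω : ℕ → X × U | 𝒜.Satisfies T (M.word L ω)} :=
    𝒜.measurableSet_satisfies (M.measurable_word hL) T
  have : Nonempty U := by
    obtain ⟨ω⟩ := nonempty_of_isProbabilityMeasure (M.closedLoop C)
    exact ⟨(ω 0).2⟩
  obtain ⟨C', hdet, hle⟩ := M.exists_isDeterministic_lintegral_le C T
    (f := {ω : ℕ → X × U | 𝒜.Satisfies T (M.word L ω)}.indicator 1) (measurable_one.indicator hm)
    (fun ω => Set.indicator_le_self' (fun _ _ => zero_le) ω) fun ω ω' h => by
      have : 𝒜.Satisfies T (M.word L ω) ↔ 𝒜.Satisfies T (M.word L ω') :=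
        exists_congr fun t => and_congr_right fun ht => by
          rw [𝒜.run_congr fun k hk => ?_]
          simp only [word, h k (by omega)]
      by_cases h1 : 𝒜.Satisfies T (M.word L ω)
      · simp [h1, this.1 h1]
      · simp [h1, mt this.2 h1]
  rw [lintegral_indicator_one hm, lintegral_indicator_one hm] at hle
  exact ⟨C', hdet, ENNReal.toReal_mono (measure_ne_top _ _) hle⟩

end GMDP

/-! ### Products of kernels and composition of simulations. -/

section PiKernel

variable {ι : Type*} [Fintype ι] {A B : ι → Type*} [∀ i, MeasurableSpace (A i)]
  [∀ i, MeasurableSpace (B i)]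

/-- The product of a finite family of Markov kernels. -/
noncomputable def piKernel (κ : ∀ i, Kernel (A i) (B i)) [∀ i, IsMarkovKernel (κ i)] :
    Kernel (∀ i, A i) (∀ i, B i) where
  toFun a := Measure.pi fun i => κ i (a i)
  measurable' := by
    refine Measurable.measure_of_isPiSystem_of_isProbabilityMeasure generateFrom_pi.symm
      isPiSystem_pi ?_
    rintro _ ⟨s, hs, rfl⟩
    simp only [Measure.pi_pi]
    exact Finset.measurable_prod _ fun i _ =>
      ((κ i).measurable_coe (hs i (Set.mem_univ i))).comp (measurable_pi_apply i)

theorem piKernel_apply (κ : ∀ i, Kernel (A i) (B i)) [∀ i, IsMarkovKernel (κ i)] (a : ∀ i, A i) :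
    piKernel κ a = Measure.pi fun i => κ i (a i) := rfl

instance (κ : ∀ i, Kernel (A i) (B i)) [∀ i, IsMarkovKernel (κ i)] :
    IsMarkovKernel (piKernel κ) :=
  ⟨fun a => by rw [piKernel_apply]; infer_instance⟩

theorem lintegral_pi_prod (μ : ∀ i, Measure (A i)) [∀ i, IsProbabilityMeasure (μ i)]
    {f : ∀ i, A i → ℝ≥0∞} (hf : ∀ i, Measurable (f i)) :
    ∫⁻ a, ∏ i, f i (a i) ∂Measure.pi μ = ∏ i, ∫⁻ x, f i x ∂μ i := by
  refine (lintegral_prod_eq_prod_lintegral_of_indepFun Finset.univ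
    (fun i (a : ∀ i, A i) => f i (a i))
    (iIndepFun_pi fun i => (hf i).aemeasurable) fun i =>
      (hf i).comp (measurable_pi_apply i)).trans ?_
  refine Finset.prod_congr rfl fun i _ => ?_
  rw [← (measurePreserving_eval μ i).map_eq, lintegral_map (hf i) (measurable_pi_apply i)]

/-- On a box both sides equal the product of the integrals of `κ i (·) (s i)`, by independence of
the coordinates under `Measure.pi μ`. -/
theorem pi_bind (μ : ∀ i, Measure (A i)) [∀ i, IsProbabilityMeasure (μ i)]
    (κ : ∀ i, Kernel (A i) (B i)) [∀ i, IsMarkovKernel (κ i)] :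
    Measure.pi (fun i => (μ i).bind (κ i)) = (Measure.pi μ).bind (piKernel κ) := by
  refine Measure.pi_eq fun s hs => ?_
  rw [Measure.bind_apply (MeasurableSet.univ_pi hs) (piKernel κ).aemeasurable]
  simp only [piKernel_apply, Measure.pi_pi]
  rw [lintegral_pi_prod μ fun i => (κ i).measurable_coe (hs i)]
  exact Finset.prod_congr rfl fun i _ =>
    (Measure.bind_apply (hs i) (κ i).aemeasurable).symm

end PiKernel

namespace GMDP

variable {N : ℕ} {Xh Uh X U Y : Fin N → Type*} [∀ i, MeasurableSpace (Xh i)]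
  [∀ i, MeasurableSpace (Uh i)] [∀ i, MeasurableSpace (X i)] [∀ i, MeasurableSpace (U i)]
  [∀ i, MetricSpace (Y i)] [∀ i, MeasurableSpace (Y i)]

/-- Simulations of the agents compose to a simulation of the multi-agent system. -/
theorem SimulatedBy.compose {Mh : ∀ i, GMDP (Xh i) (Uh i) (Y i)}
    {M : ∀ i, GMDP (X i) (U i) (Y i)} {ε : ℝ} (hε : 0 ≤ ε) {d : Fin N → ℝ} (hd : ∀ i, d i ≤ 1)
    (h : ∀ i, (Mh i).SimulatedBy (M i) ε (d i)) :
    (GMDP.compose Mh).SimulatedBy (GMDP.compose M) ε (1 - ∏ i, (1 - d i)) := by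
  choose R 𝒰 W hR h𝒰 hW hinit hdist hlift using h
  have ha : Measurable fun (p : (∀ i, Uh i) × (∀ i, Xh i) × (∀ i, X i)) i =>
      (p.1 i, p.2.1 i, p.2.2 i) := by fun_prop
  have he : Measurable fun z : ∀ i, Xh i × X i => ((fun i => (z i).1), (fun i => (z i).2)) := by
    fun_prop
  have hRm : MeasurableSet
      {p : (∀ i, Xh i) × (∀ i, X i) | ∀ i, (p.1 i, p.2 i) ∈ R i} := by
    simp only [Set.ofPred_forall]
    exact MeasurableSet.iInter fun i =>
      (show Measurable fun p : (∀ i, Xh i) × (∀ i, X i) => (p.1 i, p.2 i) by fun_prop) (hR i)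
  -- Relation, interface and lifting are taken as products; the sup metric on the outputs keeps the
  -- same `ε`.
  refine ⟨{p | ∀ i, (p.1 i, p.2 i) ∈ R i}, (piKernel 𝒰).comap _ ha,
    ((piKernel W).comap _ ha).map _, hRm, inferInstance, Kernel.IsMarkovKernel.map _ he,
    hinit, fun xh x hx => (dist_pi_le_iff hε).2 fun i => hdist i _ _ (hx i), fun uh xh x hx => ?_⟩
  have hWf : ∀ i, (W i (uh i, xh i, x i)).map Prod.fst = (Mh i).kernel (xh i, uh i) := fun i => by
    ext A hA
    rw [Measure.map_apply measurable_fst hA, ← (hlift i (uh i) (xh i) (x i) (hx i)).1 A hA,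
      Set.prod_univ]
  have hWs : ∀ i, (W i (uh i, xh i, x i)).map Prod.snd =
      (𝒰 i (uh i, xh i, x i)).bind fun u => (M i).kernel (x i, u) := fun i => by
    ext A hA
    rw [Measure.map_apply measurable_snd hA, ← (hlift i (uh i) (xh i) (x i) (hx i)).2.1 A hA,
      Set.univ_prod]
  refine ⟨fun A hA => ?_, fun A hA => ?_, ?_⟩
  · rw [Kernel.map_apply' _ he _ (hA.prod MeasurableSet.univ), Kernel.comap_apply, piKernel_apply]
    have e : (GMDP.compose Mh).kernel (xh, uh) =
        (Measure.pi fun i => W i (uh i, xh i, x i)).map fun z i => (z i).1 := by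
      rw [Measure.pi_map_pi (f := fun i => Prod.fst) fun i => measurable_fst.aemeasurable]
      simp only [hWf]
      rfl
    rw [e, Measure.map_apply (by fun_prop) hA]
    congr 1
    ext z
    simp
  · rw [Kernel.map_apply' _ he _ (MeasurableSet.univ.prod hA), Kernel.comap_apply, piKernel_apply]
    have e : ((piKernel 𝒰).comap _ ha (uh, xh, x)).bind
        (fun u => (GMDP.compose M).kernel (x, u)) =
        (Measure.pi fun i => W i (uh i, xh i, x i)).map fun z i => (z i).2 := by
      rw [Measure.pi_map_pi (f := fun i => Prod.snd) fun i => measurable_snd.aemeasurable]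
      simp only [hWs]
      exact (pi_bind (fun i => 𝒰 i (uh i, xh i, x i))
        fun i => (M i).kernel.comap (fun u => (x i, u)) (by fun_prop)).symm
    rw [e, Measure.map_apply (by fun_prop) hA]
    congr 1
    ext z
    simp
  -- Up to reordering coordinates the product relation is a box, so its probability factorises.
  -- Multiplying the lower bounds `1 - d i` requires them to be nonnegative.
  · have e : (fun z : ∀ i, Xh i × X i => ((fun i => (z i).1), (fun i => (z i).2))) ⁻¹'
        {p | ∀ i, (p.1 i, p.2 i) ∈ R i} = Set.univ.pi R := by
      ext z
      simp
    rw [Measure.real, Kernel.map_apply' _ he _ hRm, Kernel.comap_apply, piKernel_apply, e,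
      Measure.pi_pi, ENNReal.toReal_prod, sub_sub_cancel]
    exact Finset.prod_le_prod (fun i _ => sub_nonneg.2 (hd i))
      fun i _ => (hlift i (uh i) (xh i) (x i) (hx i)).2.2

end GMDP

/-! ### The main result. -/

theorem mainTheorem3 {N : ℕ} {Xh Uh X U Y AP : Fin N → Type*} {Q : Type*}
    [∀ i, MeasurableSpace (Xh i)] [∀ i, StandardBorelSpace (Xh i)]
    [∀ i, MeasurableSpace (Uh i)] [∀ i, StandardBorelSpace (Uh i)]
    [∀ i, MeasurableSpace (X i)] [∀ i, StandardBorelSpace (X i)]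
    [∀ i, MeasurableSpace (U i)] [∀ i, StandardBorelSpace (U i)]
    [∀ i, MetricSpace (Y i)] [∀ i, MeasurableSpace (Y i)] [∀ i, BorelSpace (Y i)]
    [∀ i, Finite (AP i)] [Finite Q] [MeasurableSpace Q] [DiscreteMeasurableSpace Q]
    -- the concrete agents and their abstractions
    (M : ∀ i, GMDP (X i) (U i) (Y i)) (Mh : ∀ i, GMDP (Xh i) (Uh i) (Y i))
    -- the labelling maps of the agents, and the automaton with its accepting state
    (L : ∀ i, Y i → Set (AP i)) (hL : ∀ i, Measurable (L i))
    (𝒜 : DFA (Set (Σ i, AP i)) Q) (qf : Q) (hqf : 𝒜.accept = {qf})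
    (δ : ℝ)
    -- the multi-agent abstraction is `(0, δ)`-simulated by the multi-agent system, or it is so
    -- agent by agent and `δ` is the composed deviation `1 - ∏ (1 - δ i)`
    (hsim : (GMDP.compose Mh).SimulatedBy (GMDP.compose M) 0 δ ∨
      ∃ d : Fin N → ℝ, (∀ i, 0 ≤ d i ∧ d i ≤ 1) ∧ (∀ i, (Mh i).SimulatedBy (M i) 0 (d i)) ∧
        δ = 1 - ∏ i, (1 - d i))
    (π : MarkovPolicy (∀ i, Xh i) Q (∀ i, Uh i)) :
    -- one strategy for all horizons
    (∃ C : Strategy (∀ i, X i) (∀ i, U i), ∀ T : ℕ, 1 ≤ T →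
      ((GMDP.compose Mh).value 𝒜 (GMDP.jointLabel L) π T T
          (𝒜.step 𝒜.start (GMDP.jointLabel L ((GMDP.compose Mh).out (GMDP.compose Mh).init)))
          (GMDP.compose Mh).init).toReal
        - δ * ∑ h ∈ Finset.Icc 1 T,
            (GMDP.compose Mh).hitTail 𝒜 (GMDP.measurable_jointLabel hL) π h
      ≤ (GMDP.compose M).satProb 𝒜 (GMDP.jointLabel L) C T) ∧
    -- for each horizon, a strategy that maps histories to actions without randomisation
    (∀ T : ℕ, 1 ≤ T → ∃ C : Strategy (∀ i, X i) (∀ i, U i), C.IsDeterministic ∧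
      ((GMDP.compose Mh).value 𝒜 (GMDP.jointLabel L) π T T
          (𝒜.step 𝒜.start (GMDP.jointLabel L ((GMDP.compose Mh).out (GMDP.compose Mh).init)))
          (GMDP.compose Mh).init).toReal
        - δ * ∑ h ∈ Finset.Icc 1 T,
            (GMDP.compose Mh).hitTail 𝒜 (GMDP.measurable_jointLabel hL) π h
      ≤ (GMDP.compose M).satProb 𝒜 (GMDP.jointLabel L) C T) := by

  have hsim' : (GMDP.compose Mh).SimulatedBy (GMDP.compose M) 0 δ := by
    rcases hsim with h | ⟨d, hd, h, rfl⟩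
    · exact h
    · exact GMDP.SimulatedBy.compose le_rfl (fun i => (hd i).2) h
  obtain ⟨C, hC⟩ := hsim'.exists_strategy
    ((GMDP.compose Mh).policyStrategy 𝒜 (GMDP.measurable_jointLabel hL) π) 𝒜
    (GMDP.measurable_jointLabel hL)
  have hC' : ∀ T : ℕ,
      ((GMDP.compose Mh).value 𝒜 (GMDP.jointLabel L) π T T
          (𝒜.step 𝒜.start (GMDP.jointLabel L ((GMDP.compose Mh).out (GMDP.compose Mh).init)))
          (GMDP.compose Mh).init).toReal
        - δ * ∑ h ∈ Finset.Icc 1 T,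
            (GMDP.compose Mh).hitTail 𝒜 (GMDP.measurable_jointLabel hL) π h
      ≤ (GMDP.compose M).satProb 𝒜 (GMDP.jointLabel L) C T := fun T => by
    -- Once the value is a satisfaction probability, the claim is the refinement bound for
    -- `policyStrategy`, up to unfolding `satProb` and `hitTail`.
    rw [GMDP.value_init_eq _ 𝒜 (GMDP.measurable_jointLabel hL)]
    exact hC T
  refine ⟨⟨C, fun T _ => hC' T⟩, fun T _ => ?_⟩
  obtain ⟨D, hD, hle⟩ := (GMDP.compose M).exists_isDeterministic_satProb_le 𝒜
    (GMDP.measurable_jointLabel hL) C T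
  exact ⟨D, hD, (hC' T).trans hle⟩
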